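/- Let $0<\alpha<1$, $T>0$, and let $M_0,M_1\ge 0$. There is a constant $C$, depending only on $\alpha$, $T$, $M_0$ and $M_1$, such that the following holds. Let $\Omega\subset\mathbb{R}^d$ ($d\ge1$) be a polyhedral domain, that is, a non-empty connected open set which is the interior of its closure and whose closure is a finite union of convex polytopes. Let $F:\Omega\times(0,T)\to\mathbb{R}^d$ be such that $F$ and its (distributional) time derivative $\partial_tF$ belong to $L_\infty(\Omega\times(0,T),\mathbb{R}^d)$ with essential suprema of the Euclidean norms $|F|$ and $|\partial_tF|$ at most $M_0$ and $M_1$, respectively. Given any conforming triangulation of $\overline\Omega$ into finitely many $d$-simplices, let $\mathbb{S}_h$ be either the space of all continuous functions on $\overline\Omega$ that are affine on each simplex and vanish on $\partial\Omega$ (homogeneous Dirichlet boundary condition), or the space of all continuous functions on $\overline\Omega$ that are affine on each simplex (zero-flux boundary condition). Write $\langle v,w\rangle=\int_\Omega v\,w$ for scalar functions, $\langle v,w\rangle=\int_\Omega v\cdot w$ for vector fields, $\|v\|=\langle v,v\rangle^{1/2}$, and let $$\partial_t^{1-\alpha}\phi=\partial_t\mathcal{I}^\alpha\phi,\qquad \mathcal{I}^\alpha\phi(t)=\int_0^t\frac{(t-s)^{\alpha-1}}{\Gamma(\alpha)}\,\phi(s)\,ds$$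 be the Riemann–Liouville derivative of order $1-\alpha$. Let $u_h:[0,T]\to\mathbb{S}_h$ be a semidiscrete Galerkin finite element solution of the time-fractional Fokker–Planck equation $\partial_tu-\nabla\cdot(\partial_t^{1-\alpha}\nabla u-F\,\partial_t^{1-\alpha}u)=0$ with initial value $u_{0h}\in\mathbb{S}_h$; that is, $u_h$ is continuous on $[0,T]$, absolutely continuous on $[\varepsilon,T]$ for every $0<\varepsilon<T$ (in particular, it may be any solution that is continuous on $[0,T]$ and continuously differentiable on $(0,T]$), satisfies $u_h(0)=u_{0h}$, and $$\langle\partial_tu_h,\chi\rangle+\langle\partial_t^{1-\alpha}\nabla u_h,\nabla\chi\rangle-\langle F\,\partial_t^{1-\alpha}u_h,\nabla\chi\rangle=0\quad\text{for all }\chi\in\mathbb{S}_h\text{ and almost all }t\in(0,T).$$ Then $$\|u_h(t)\|\le C\,\|u_{0h}\|\qquad\text{for all }0\le t\le T.$$ -/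

import Mathlib

namespace FokkerPlanck

open MeasureTheory Set
open scoped ContDiff

/-! ### Polyhedral domains, triangulations, piecewise-linear finite elements -/

/-- `Ω ⊆ ℝᵈ` is a polyhedral domain: a nonempty connected open set that is the interior of its
closure, the closure being a finite union of convex polytopes (convex hulls of finite sets).
In particular `Ω` is bounded. -/
structure IsPolyhedralDomain {d : ℕ} (Ω : Set (EuclideanSpace ℝ (Fin d))) : Prop where
  isOpen : IsOpen Ω
  isConnected : IsConnected Ω
  interior_closure : interior (closure Ω) = Ω
  polyhedral : ∃ P : Set (Finset (EuclideanSpace ℝ (Fin d))), P.Finite ∧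
    closure Ω = ⋃ s ∈ P, convexHull ℝ (s : Set (EuclideanSpace ℝ (Fin d)))

/-- `K` is a (conforming) triangulation of `Ω`: a finite simplicial complex whose simplices fill
`closure Ω`, every simplex being a face of a `d`-dimensional one (an element of the mesh).
Conformity, i.e. that two simplices meet in a common face, is part of
`Geometry.SimplicialComplex`. -/
structure IsTriangulation {d : ℕ} (Ω : Set (EuclideanSpace ℝ (Fin d)))
    (K : Geometry.SimplicialComplex ℝ (EuclideanSpace ℝ (Fin d))) : Prop where
  finite : K.faces.Finite
  pure : ∀ s ∈ K.faces, ∃ e ∈ K.faces, s ⊆ e ∧ e.card = d + 1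
  space_eq : K.space = closure Ω

/-- The two types of boundary condition. -/
inductive BoundaryCondition
  | dirichlet
  | zeroFlux

/-- The finite element space: continuous functions on `closure Ω` that are affine on every simplex
of `K`, and that vanish on `∂Ω` in the case of the Dirichlet boundary condition.
A function on `closure Ω` is represented by its extension by zero to `ℝᵈ`. -/
def feSpace {d : ℕ} (Ω : Set (EuclideanSpace ℝ (Fin d)))
    (K : Geometry.SimplicialComplex ℝ (EuclideanSpace ℝ (Fin d))) (bc : BoundaryCondition) :
    Submodule ℝ (EuclideanSpace ℝ (Fin d) → ℝ) where
  carrier := {v | ContinuousOn v (closure Ω) ∧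
    (∀ s ∈ K.faces, ∃ g : EuclideanSpace ℝ (Fin d) →ᵃ[ℝ] ℝ,
      EqOn v g (convexHull ℝ (s : Set (EuclideanSpace ℝ (Fin d))))) ∧
    (bc = BoundaryCondition.dirichlet → ∀ x ∈ frontier Ω, v x = 0) ∧
    ∀ x, x ∉ closure Ω → v x = 0}
  zero_mem' := ⟨continuousOn_const, fun _ _ => ⟨0, fun _ _ => rfl⟩, fun _ _ _ => rfl,
    fun _ _ => rfl⟩
  add_mem' := by
    rintro v w ⟨hv1, hv2, hv3, hv4⟩ ⟨hw1, hw2, hw3, hw4⟩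
    refine ⟨hv1.add hw1, fun s hs => ?_, fun hb x hx => ?_, fun x hx => ?_⟩
    · obtain ⟨g, hg⟩ := hv2 s hs
      obtain ⟨k, hk⟩ := hw2 s hs
      exact ⟨g + k, fun x hx => by simp [hg hx, hk hx]⟩
    · simp [hv3 hb x hx, hw3 hb x hx]
    · simp [hv4 x hx, hw4 x hx]
  smul_mem' := by
    rintro c v ⟨hv1, hv2, hv3, hv4⟩
    refine ⟨hv1.const_smul c, fun s hs => ?_, fun hb x hx => ?_, fun x hx => ?_⟩
    · obtain ⟨g, hg⟩ := hv2 s hs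
      exact ⟨c • g, fun x hx => by simp [hg hx]⟩
    · simp [hv3 hb x hx]
    · simp [hv4 x hx]

/-! ### Inner products over `Ω` -/

/-- `⟨v, w⟩ = ∫_Ω v w` for scalar functions. -/
noncomputable def ip {d : ℕ} (Ω : Set (EuclideanSpace ℝ (Fin d)))
    (v w : EuclideanSpace ℝ (Fin d) → ℝ) : ℝ :=
  ∫ x in Ω, v x * w x

/-- `⟨v, w⟩ = ∫_Ω v · w` for vector fields. -/
noncomputable def ipVec {d : ℕ} (Ω : Set (EuclideanSpace ℝ (Fin d)))
    (v w : EuclideanSpace ℝ (Fin d) → EuclideanSpace ℝ (Fin d)) : ℝ :=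
  ∫ x in Ω, inner ℝ (v x) (w x)

/-- The norm `‖v‖ = √⟨v, v⟩` of `L₂(Ω)`. -/
noncomputable def l2Norm {d : ℕ} (Ω : Set (EuclideanSpace ℝ (Fin d)))
    (v : EuclideanSpace ℝ (Fin d) → ℝ) : ℝ :=
  Real.sqrt (ip Ω v v)

/-! ### Fractional calculus in time -/

/-- The kernel `ω_α(t) = t^(α-1) / Γ(α)`. -/
noncomputable def omega (α t : ℝ) : ℝ := t ^ (α - 1) / Real.Gamma α

/-- The fractional integral `(I^α φ)(t) = ∫₀ᵗ ω_α(t-s) φ(s) ds`. -/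
noncomputable def fracInt {X : Type*} [NormedAddCommGroup X] [NormedSpace ℝ X]
    (α : ℝ) (φ : ℝ → X) (t : ℝ) : X :=
  ∫ s in (0 : ℝ)..t, omega α (t - s) • φ s

/-- The Riemann–Liouville derivative of order `1 - α`, i.e. `∂ₜ^(1-α) φ = ∂ₜ (I^α φ)`. -/
noncomputable def fracDeriv {X : Type*} [NormedAddCommGroup X] [NormedSpace ℝ X]
    (α : ℝ) (φ : ℝ → X) (t : ℝ) : X :=
  deriv (fracInt α φ) t

/-! ### The forcing -/

/-- `G = ∂ₜF` on the space-time cylinder `Ω × (0,T)`, in the sense of distributions. -/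
def HasWeakTimeDeriv {d : ℕ} (Ω : Set (EuclideanSpace ℝ (Fin d))) (T : ℝ)
    (F G : EuclideanSpace ℝ (Fin d) × ℝ → EuclideanSpace ℝ (Fin d)) : Prop :=
  ∀ φ : EuclideanSpace ℝ (Fin d) × ℝ → ℝ, ContDiff ℝ ∞ φ → HasCompactSupport φ →
    tsupport φ ⊆ Ω ×ˢ Ioo 0 T →
    ∫ z in Ω ×ˢ Ioo 0 T, deriv (fun s => φ (z.1, s)) z.2 • F z
      = -∫ z in Ω ×ˢ Ioo 0 T, φ z • G z

/-- `F` and `∂ₜF` belong to `L_∞(Ω × (0,T), ℝᵈ)`, with norms at most `M₀` and `M₁`. -/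
def IsForcing {d : ℕ} (Ω : Set (EuclideanSpace ℝ (Fin d))) (T : ℝ) (M₀ M₁ : NNReal)
    (F : EuclideanSpace ℝ (Fin d) × ℝ → EuclideanSpace ℝ (Fin d)) : Prop :=
  (MemLp F ⊤ (volume.restrict (Ω ×ˢ Ioo 0 T)) ∧
    eLpNorm F ⊤ (volume.restrict (Ω ×ˢ Ioo 0 T)) ≤ M₀) ∧
  ∃ G : EuclideanSpace ℝ (Fin d) × ℝ → EuclideanSpace ℝ (Fin d),
    HasWeakTimeDeriv Ω T F G ∧
    MemLp G ⊤ (volume.restrict (Ω ×ˢ Ioo 0 T)) ∧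
    eLpNorm G ⊤ (volume.restrict (Ω ×ˢ Ioo 0 T)) ≤ M₁

/-! ### The semidiscrete finite element solution -/

/-- `u : [0,T] → S_h` is a semidiscrete finite element solution with initial value `u₀`:
it is continuous on `[0,T]`, absolutely continuous on `[ε,T]` for each `0 < ε < T`
(as is every function that is continuously differentiable on `(0,T]`), satisfies `u(0) = u₀`, and
`⟨∂ₜu, χ⟩ + ⟨∂ₜ^(1-α)∇u, ∇χ⟩ - ⟨F ∂ₜ^(1-α)u, ∇χ⟩ = 0` for all `χ ∈ S_h` and almost all
`t ∈ (0,T)`.  As `S_h` is finite-dimensional, regularity in time may be tested pointwise in `x`.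
`gradient` is the classical gradient, which exists at every interior point of a mesh element. -/
structure IsSemidiscreteSolution {d : ℕ} (Ω : Set (EuclideanSpace ℝ (Fin d)))
    (K : Geometry.SimplicialComplex ℝ (EuclideanSpace ℝ (Fin d))) (bc : BoundaryCondition)
    (α T : ℝ) (F : EuclideanSpace ℝ (Fin d) × ℝ → EuclideanSpace ℝ (Fin d))
    (u₀ : EuclideanSpace ℝ (Fin d) → ℝ) (u : ℝ → EuclideanSpace ℝ (Fin d) → ℝ) : Prop where
  mem : ∀ t ∈ Icc 0 T, u t ∈ feSpace Ω K bc
  continuous : ∀ x ∈ closure Ω, ContinuousOn (fun t => u t x) (Icc 0 T)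
  absolutelyContinuous : ∀ x ∈ closure Ω, ∀ ε ∈ Ioo 0 T,
    AbsolutelyContinuousOnInterval (fun t => u t x) ε T
  initial : u 0 = u₀
  equation : ∀ᵐ t ∂(volume.restrict (Ioo 0 T)), ∀ χ ∈ feSpace Ω K bc,
    ip Ω (fun x => deriv (fun s => u s x) t) χ
      + ipVec Ω (fun x => fracDeriv α (fun s => gradient (u s) x) t) (gradient χ)
      - ipVec Ω (fun x => fracDeriv α (fun s => u s x) t • F (x, t)) (gradient χ) = 0

end FokkerPlanck

/-!
The stability constant comes from an `L¹`-in-time argument that uses only the bound `M₀` on `F`.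

Write `u` for the finite element solution, `w = ∂ₜ^(1-α) u`, and `ω_α(t) = t^(α-1) / Γ(α)`, and
regard all three as functions of time with values in `H = L₂(Ω)`.  Testing the equation with
`χ = w(t)` and using `M₀ ‖w‖ ‖∇w‖ ≤ ‖∇w‖² + (M₀² / 4) ‖w‖²` gives `⟨∂ₜu, w⟩ ≤ c ‖w‖²` with
`c = M₀² / 4`.  On the other hand `u = I^(1-α) w`, that is, `w = ω_α u(0) + I^α ∂ₜu`.
The operator `∂ₜ I^(1-α)` is accretive in `L¹(0, T; H)`, since its kernel is decreasing; pairing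
the equation with `w / ‖w‖` therefore shows that `‖w‖` is a subsolution of the scalar problem,
`‖w‖ ≤ ω_α ‖u(0)‖ + c I^α ‖w‖` (`norm_le_omega_add_convolution`).  The pairing is justified with
the regularized kernel `(t + δ)^(-α)`: composed with `I^α`, its derivative is convolution by the
explicit approximate identity `δ⁻¹ η(t / δ)`, `η(t) = t^(α-1) / ((1 + t) Γ(α))`
(`weighted_scaled_profile_eq`).  With the weight `e^(-σt)` the kernel `ω_α` has mass `σ^(-α)`, so
that for large `σ` the scalar inequality bounds the weighted `L¹` norm of `w`, and convolving once
more with `t^(-α)`, whose convolution with `ω_α` is constant, bounds `u` pointwise in time: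
`‖u(t)‖ ≤ 2 e^(σT) ‖u(0)‖` (`exp_mul_norm_le_two_mul`).

The solution is only assumed to be absolutely continuous on `[ε, T]`, so the integrability of `w`
and `∂ₜu` up to `t = 0` has to be proved (`integrableOn_and_eq_omega_add`).  On the fixed finite
element space the equation gives `‖∂ₜu‖ ≤ C ‖w‖`, with `C` depending on the mesh through an inverse
inequality.  For `t > ε`, `w(t)` is `ω_α(t) u(ε) + ∫_ε^t ω_α(t-s) ∂ₜu(s) ds` up to a history term
bounded by the oscillation of `u` on `[0, ε]` times `ω_α(t - ε)` (`ae_hasDerivAt_fracInt`); a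
weighted Gronwall argument in `L¹(ε, T)` is uniform in `ε`, and `ε → 0` yields integrability and the
representation of `w`.  The mesh-dependent constant `C` enters only this qualitative step.
-/

open MeasureTheory Set Filter Topology
open scoped Convolution ENNReal

namespace FokkerPlanck

/-! ### Convolution on the real line -/

section Convolution

variable {H : Type*} [NormedAddCommGroup H] [NormedSpace ℝ H]

theorem convolution_add_ae {k : ℝ → ℝ} {f g : ℝ → H} (hk : Integrable k) (hf : Integrable f)
    (hg : Integrable g) : k ⋆ (f + g) =ᵐ[volume] k ⋆ f + k ⋆ g := by
  filter_upwards [hk.ae_convolution_exists (ContinuousLinearMap.lsmul ℝ ℝ) hf,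
    hk.ae_convolution_exists (ContinuousLinearMap.lsmul ℝ ℝ) hg] with t h1 h2
  exact h1.distrib_add h2

theorem sub_convolution_ae {k l : ℝ → ℝ} {f : ℝ → H} (hk : Integrable k) (hl : Integrable l)
    (hf : Integrable f) : (k - l) ⋆ f =ᵐ[volume] k ⋆ f - l ⋆ f := by
  filter_upwards [hk.ae_convolution_exists (ContinuousLinearMap.lsmul ℝ ℝ) hf,
    hl.ae_convolution_exists (ContinuousLinearMap.lsmul ℝ ℝ) hf] with t h1 h2
  simp only [convolution_def, Pi.sub_apply, ContinuousLinearMap.lsmul_apply, sub_smul]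
  exact integral_sub h1 h2

theorem convolution_sub_ae {k : ℝ → ℝ} {f g : ℝ → H} (hk : Integrable k) (hf : Integrable f)
    (hg : Integrable g) : k ⋆ (f - g) =ᵐ[volume] k ⋆ f - k ⋆ g := by
  filter_upwards [hk.ae_convolution_exists (ContinuousLinearMap.lsmul ℝ ℝ) hf,
    hk.ae_convolution_exists (ContinuousLinearMap.lsmul ℝ ℝ) hg] with t h1 h2
  simp only [convolution_def, Pi.sub_apply, ContinuousLinearMap.lsmul_apply, smul_sub]
  exact integral_sub h1 h2

theorem convolution_ae_congr {k : ℝ → ℝ} {f g : ℝ → H} (h : f =ᵐ[volume] g) :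
    k ⋆ f = k ⋆ g :=
  convolution_congr _ (ae_eq_refl k) h

theorem convolution_smul_const [CompleteSpace H] (k l : ℝ → ℝ) (v : H) :
    k ⋆ (fun t => l t • v) = fun t => (k ⋆ l) t • v := by
  ext t
  simp only [convolution_def, ContinuousLinearMap.lsmul_apply, smul_eq_mul]
  rw [← integral_smul_const]
  simp only [mul_smul]

theorem convolution_assoc_ae [CompleteSpace H] {k l : ℝ → ℝ} {f : ℝ → H} (hk : Integrable k)
    (hl : Integrable l) (hf : Integrable f) : (k ⋆ l) ⋆ f =ᵐ[volume] k ⋆ (l ⋆ f) := by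
  have h1 := hl.norm.integrable_convolution (ContinuousLinearMap.mul ℝ ℝ) hf.norm
  filter_upwards [hk.norm.ae_convolution_exists (ContinuousLinearMap.mul ℝ ℝ) h1] with t ht
  refine convolution_assoc _ _ _ _ (fun x y z => ?_) hk.aestronglyMeasurable
    hl.aestronglyMeasurable hf.aestronglyMeasurable (hk.ae_convolution_exists _ hl)
    (hl.norm.ae_convolution_exists _ hf.norm) ht
  simp only [ContinuousLinearMap.lsmul_apply, smul_eq_mul, mul_smul]

theorem convolution_comm_real (k l : ℝ → ℝ) : k ⋆ l = l ⋆ k := by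
  ext t
  rw [convolution_lsmul, convolution_lsmul_swap]
  simp only [smul_eq_mul, mul_comm]

theorem norm_convolution_le {k : ℝ → ℝ} (hk : ∀ t, 0 ≤ k t) (f : ℝ → H) (t : ℝ) :
    ‖(k ⋆ f) t‖ ≤ (k ⋆ fun s => ‖f s‖) t := by
  simp only [convolution_def, ContinuousLinearMap.lsmul_apply, smul_eq_mul]
  refine (norm_integral_le_integral_norm _).trans_eq ?_
  simp only [norm_smul, Real.norm_of_nonneg (hk _)]

theorem convolution_nonneg {k l : ℝ → ℝ} (hk : ∀ t, 0 ≤ k t) (hl : ∀ t, 0 ≤ l t) (t : ℝ) :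
    0 ≤ (k ⋆ l) t := by
  simp only [convolution_def, ContinuousLinearMap.lsmul_apply, smul_eq_mul]
  exact integral_nonneg fun s => mul_nonneg (hk _) (hl _)

theorem convolution_mono_ae {k f g : ℝ → ℝ} (hk : Integrable k) (hk0 : ∀ t, 0 ≤ k t)
    (hf : Integrable f) (hg : Integrable g) (h : f ≤ᵐ[volume] g) : k ⋆ f ≤ᵐ[volume] k ⋆ g := by
  filter_upwards [hk.ae_convolution_exists (ContinuousLinearMap.lsmul ℝ ℝ) hf,
    hk.ae_convolution_exists (ContinuousLinearMap.lsmul ℝ ℝ) hg] with t h1 h2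
  refine integral_mono_ae h1 h2 ?_
  filter_upwards [(quasiMeasurePreserving_sub_left_of_right_invariant volume t).ae h] with s hs
  exact mul_le_mul_of_nonneg_left hs (hk0 s)

theorem integral_convolution_real {k l : ℝ → ℝ} (hk : Integrable k) (hl : Integrable l) :
    ∫ t, (k ⋆ l) t = (∫ t, k t) * ∫ t, l t := by
  rw [integral_convolution _ hk hl]; simp

end Convolution

/-! ### Exponentially weighted causal functions -/

section Weighted

variable {H : Type*} [NormedAddCommGroup H] [NormedSpace ℝ H]

/-- The function `t ↦ e^(-σt) a(t)` on the positive half-line, extended by zero.  For `σ > 0` the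
weight makes power-law kernels integrable, and it is compatible with convolution. -/
noncomputable def weighted (σ : ℝ) (a : ℝ → H) : ℝ → H :=
  (Ioi (0 : ℝ)).indicator fun t => Real.exp (-σ * t) • a t

theorem weighted_of_pos {σ t : ℝ} (ht : 0 < t) (a : ℝ → H) :
    weighted σ a t = Real.exp (-σ * t) • a t := indicator_of_mem (mem_Ioi.2 ht) _

theorem weighted_of_nonpos {σ t : ℝ} (ht : t ≤ 0) (a : ℝ → H) : weighted σ a t = 0 :=
  indicator_of_notMem (by simpa using ht) _

theorem weighted_nonneg (σ : ℝ) {a : ℝ → ℝ} (ha : ∀ t, 0 < t → 0 ≤ a t) (t : ℝ) :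
    0 ≤ weighted σ a t :=
  indicator_nonneg (fun t ht => mul_nonneg (Real.exp_pos _).le (ha t ht)) t

theorem weighted_convolution (σ : ℝ) (a : ℝ → ℝ) (b : ℝ → H) :
    weighted σ a ⋆ weighted σ b = weighted σ fun t => ∫ s in (0 : ℝ)..t, a (t - s) • b s := by
  ext t
  rw [convolution_lsmul_swap]
  rcases le_or_gt t 0 with ht | ht
  · rw [weighted_of_nonpos ht]
    refine integral_eq_zero_of_ae (Eventually.of_forall fun s => ?_)
    rcases le_or_gt s 0 with hs | hs
    · simp [weighted_of_nonpos hs]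
    · simp [weighted_of_nonpos (show t - s ≤ 0 by linarith)]
  · rw [weighted_of_pos ht, ← intervalIntegral.integral_smul, intervalIntegral.integral_of_le ht.le,
      integral_Ioc_eq_integral_Ioo, ← integral_indicator measurableSet_Ioo]
    congr 1
    ext s
    by_cases hs : s ∈ Ioo 0 t
    · rw [indicator_of_mem hs, weighted_of_pos hs.1, weighted_of_pos (sub_pos.2 hs.2), smul_smul,
        smul_smul]
      congr 1
      rw [smul_eq_mul, show -σ * t = -σ * (t - s) + -σ * s by ring, Real.exp_add]
      ring
    · rw [indicator_of_notMem hs]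
      rcases le_or_gt s 0 with h | h
      · simp [weighted_of_nonpos h]
      · have : t - s ≤ 0 := by
          by_contra hh
          exact hs ⟨h, by linarith⟩
        simp [weighted_of_nonpos this]

end Weighted

/-! ### Approximate identities in `L¹` -/

section ApproxIdentity

variable {H : Type*} [NormedAddCommGroup H] [NormedSpace ℝ H]

omit [NormedSpace ℝ H] in
theorem tendsto_lintegral_translate_sub {f : ℝ → H} (hf : Integrable f) :
    Tendsto (fun r : ℝ => ∫⁻ t, ‖f (t - r) - f t‖ₑ) (𝓝 0) (𝓝 0) := by
  let g : ℝ → C(ℝ, ℝ) := fun r => ⟨fun t => t - r, by fun_prop⟩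
  have hg : Continuous g :=
    ContinuousMap.continuous_of_continuous_uncurry _ (by
      simp only [Function.uncurry_def]; exact continuous_snd.sub continuous_fst)
  have hgm : ∀ r, MeasurePreserving (g r) volume volume := fun r => measurePreserving_sub_right _ r
  have h := (continuous_const (y := hf.toL1 f) (X := ℝ)).compMeasurePreservingLp hg hgm (by simp)
  have h2 := tendsto_iff_edist_tendsto_0.1 (h.tendsto 0)
  refine h2.congr fun r => ?_
  rw [Lp.edist_def, eLpNorm_one_eq_lintegral_enorm]
  refine lintegral_congr_ae ?_
  have e : ∀ r, (Lp.compMeasurePreserving (g r) (hgm r) (hf.toL1 f) : ℝ → H) =ᵐ[volume]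
      fun t => f (t - r) := fun r =>
    (Lp.coeFn_compMeasurePreserving _ (hgm r)).trans
      ((hgm r).quasiMeasurePreserving.ae_eq_comp hf.coeFn_toL1)
  filter_upwards [e r, e 0] with t h1 h2
  simp only [Pi.sub_apply]
  rw [h1, h2, sub_zero]

theorem tendsto_lintegral_weighted_translate_sub {f : ℝ → H} (hf : Integrable f) (σ : ℝ) :
    Tendsto (fun r : ℝ => ∫⁻ t, ‖Real.exp (-σ * r) • f (t - r) - f t‖ₑ) (𝓝 0) (𝓝 0) := by
  have h1 : Tendsto (fun r : ℝ => ‖Real.exp (-σ * r)‖ₑ * (∫⁻ t, ‖f (t - r) - f t‖ₑ) +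
      ‖Real.exp (-σ * r) - 1‖ₑ * ∫⁻ t, ‖f t‖ₑ) (𝓝 0)
      (𝓝 (‖Real.exp (-σ * 0)‖ₑ * 0 + ‖Real.exp (-σ * 0) - 1‖ₑ * ∫⁻ t, ‖f t‖ₑ)) := by
    refine Tendsto.add (ENNReal.Tendsto.mul ?_ (Or.inr (by simp)) 
      (tendsto_lintegral_translate_sub hf) (Or.inr (by simp))) 
      (ENNReal.Tendsto.mul_const ?_ (Or.inr hf.2.ne))
    · exact (Continuous.tendsto (by fun_prop) 0)
    · exact (Continuous.tendsto (by fun_prop) 0)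
  simp only [mul_zero, Real.exp_zero, sub_self, enorm_zero, zero_mul, add_zero] at h1
  refine tendsto_of_tendsto_of_tendsto_of_le_of_le tendsto_const_nhds h1 (fun _ => zero_le)
    fun r => ?_
  have hm : AEMeasurable (fun t => ‖f (t - r) - f t‖ₑ) :=
    ((hf.comp_sub_right r).sub hf).aestronglyMeasurable.enorm
  rw [← lintegral_const_mul'' _ hm, ← lintegral_const_mul' _ _ (by simp),
    ← lintegral_add_left' (hm.const_mul _)]
  refine lintegral_mono fun t => ?_
  rw [← enorm_smul, ← enorm_smul]
  refine le_trans (le_of_eq ?_) (enorm_add_le _ _)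
  congr 1
  rw [smul_sub, sub_smul, one_smul]
  abel

/-- Rescalings of an integrable kernel, multiplied by `e^(-σt)`, form an approximate identity
in `L¹`. -/
theorem tendsto_lintegral_weighted_scaled_convolution_sub [CompleteSpace H] {η : ℝ → ℝ}
    (hη : IntegrableOn η (Ioi 0))
    {σ : ℝ} (hσ : 0 ≤ σ) {f : ℝ → H} (hf : Integrable f)
    (hint : ∀ δ, 0 < δ → Integrable (weighted σ fun t => δ⁻¹ * η (t / δ))) :
    Tendsto (fun δ : ℝ => ∫⁻ t, ‖((weighted σ fun t => δ⁻¹ * η (t / δ)) ⋆ f) t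
      - (∫ t in Ioi 0, η t) • f t‖ₑ) (𝓝[>] 0) (𝓝 0) := by
  have hN := tendsto_lintegral_weighted_translate_sub hf σ
  have hmeas : ∀ δ : ℝ, AEStronglyMeasurable (fun p : ℝ × ℝ =>
      Real.exp (-σ * (δ * p.1)) • f (p.2 - δ * p.1) - f p.2)
      ((volume.restrict (Ioi 0)).prod volume) := by
    intro δ
    refine AEStronglyMeasurable.sub (AEStronglyMeasurable.smul ?_ ?_)
      hf.aestronglyMeasurable.comp_snd
    · exact (Continuous.aestronglyMeasurable (by fun_prop))
    · refine hf.aestronglyMeasurable.comp_quasiMeasurePreserving ?_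
      exact QuasiMeasurePreserving.prod_of_right (by fun_prop) (Eventually.of_forall fun τ =>
        (measurePreserving_sub_right volume (δ * τ)).quasiMeasurePreserving)
  have hbound : ∀ r : ℝ, 0 ≤ r →
      ∫⁻ t, ‖Real.exp (-σ * r) • f (t - r) - f t‖ₑ ≤ 2 * ∫⁻ t, ‖f t‖ₑ := by
    intro r hr
    have h1 : ∀ t, ‖Real.exp (-σ * r) • f (t - r) - f t‖ₑ ≤ ‖f (t - r)‖ₑ + ‖f t‖ₑ := by
      intro t
      refine enorm_sub_le.trans ?_
      gcongr
      rw [enorm_smul]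
      refine mul_le_of_le_one_left' ?_
      rw [← ofReal_norm, Real.norm_of_nonneg (Real.exp_pos _).le]
      refine ENNReal.ofReal_le_one.2 (Real.exp_le_one_iff.2 ?_)
      nlinarith
    refine (lintegral_mono h1).trans ?_
    rw [lintegral_add_right' _ hf.aestronglyMeasurable.enorm,
      lintegral_sub_right_eq_self (fun t => ‖f t‖ₑ) r, two_mul]
  have key : Tendsto (fun δ : ℝ => ∫⁻ τ in Ioi (0:ℝ), ‖η τ‖ₑ *
      ∫⁻ t, ‖Real.exp (-σ * (|δ| * τ)) • f (t - |δ| * τ) - f t‖ₑ) (𝓝 0)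
      (𝓝 (∫⁻ τ in Ioi (0:ℝ), 0)) := by
    refine tendsto_of_seq_tendsto fun u hu => ?_
    refine tendsto_lintegral_of_dominated_convergence'
      (fun τ => ‖η τ‖ₑ * (2 * ∫⁻ t, ‖f t‖ₑ)) (fun n => ?_) (fun n => ?_) ?_ ?_
    · exact hη.aestronglyMeasurable.enorm.mul ((hmeas |u n|).enorm.lintegral_prod_right')
    · refine (ae_restrict_iff' measurableSet_Ioi).2 (Eventually.of_forall fun τ hτ => ?_)
      dsimp only
      gcongr
      exact hbound _ (mul_nonneg (abs_nonneg _) (le_of_lt hτ))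
    · rw [lintegral_mul_const'' _ hη.aestronglyMeasurable.enorm]
      exact ENNReal.mul_ne_top hη.2.ne (ENNReal.mul_ne_top (by simp) hf.2.ne)
    · refine (ae_restrict_iff' measurableSet_Ioi).2 (Eventually.of_forall fun τ hτ => ?_)
      have : Tendsto (fun n => |u n| * τ) atTop (𝓝 0) := by
        simpa using hu.abs.mul_const τ
      have h2 := ENNReal.Tendsto.const_mul (a := ‖η τ‖ₑ) (hN.comp this) (Or.inr (by simp))
      simpa using h2
  rw [lintegral_zero] at key
  refine tendsto_of_tendsto_of_tendsto_of_le_of_le' tendsto_const_nhds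
    (key.mono_left nhdsWithin_le_nhds)
    (Eventually.of_forall fun _ => zero_le) ?_
  filter_upwards [self_mem_nhdsWithin] with δ hδ
  rw [mem_Ioi] at hδ
  rw [abs_of_pos hδ]
  have hswap : ∫⁻ τ in Ioi (0:ℝ), ‖η τ‖ₑ *
      ∫⁻ t, ‖Real.exp (-σ * (δ * τ)) • f (t - δ * τ) - f t‖ₑ =
      ∫⁻ t, ∫⁻ τ in Ioi (0:ℝ), ‖η τ‖ₑ * ‖Real.exp (-σ * (δ * τ)) • f (t - δ * τ) - f t‖ₑ := by
    rw [← lintegral_lintegral_swap]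
    · refine lintegral_congr fun τ => ?_
      rw [lintegral_const_mul' _ _ (by simp)]
    · exact (hη.aestronglyMeasurable.enorm.comp_fst).mul (hmeas δ).enorm
  rw [hswap]
  refine lintegral_mono_ae ?_
  filter_upwards [(hint δ hδ).ae_convolution_exists (ContinuousLinearMap.lsmul ℝ ℝ) hf] with t ht
  -- the substitution `s = δ τ` in the convolution integral
  have hfun : (fun s => (weighted σ (fun t => δ⁻¹ * η (t / δ)) s) • f (t - s)) =
      (Ioi 0).indicator fun s => (Real.exp (-σ * s) * (δ⁻¹ * η (s / δ))) • f (t - s) := by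
    ext s
    by_cases hs : s ∈ Ioi (0:ℝ)
    · rw [indicator_of_mem hs, weighted_of_pos hs, smul_eq_mul]
    · rw [indicator_of_notMem hs, weighted_of_nonpos (by simpa using hs), zero_smul]
  have hcomp : ∀ τ, (Real.exp (-σ * (δ * τ)) * (δ⁻¹ * η (δ * τ / δ))) • f (t - δ * τ) =
      δ⁻¹ • (η τ • Real.exp (-σ * (δ * τ)) • f (t - δ * τ)) := by
    intro τ
    rw [mul_div_cancel_left₀ _ hδ.ne', smul_smul, smul_smul]
    congr 1
    ring
  have hi1 : IntegrableOn (fun τ => η τ • Real.exp (-σ * (δ * τ)) • f (t - δ * τ)) (Ioi 0) := by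
    have h1 : Integrable fun s => (weighted σ (fun t => δ⁻¹ * η (t / δ)) s) • f (t - s) := ht
    rw [hfun, integrable_indicator_iff measurableSet_Ioi] at h1
    have h2 := (integrableOn_Ioi_comp_mul_left_iff
      (fun s => (Real.exp (-σ * s) * (δ⁻¹ * η (s / δ))) • f (t - s)) 0 hδ).2
      (by rw [mul_zero]; exact h1)
    simp only [hcomp] at h2
    have h3 := h2.smul δ
    refine h3.congr (Eventually.of_forall fun τ => ?_)
    simp only [Pi.smul_apply]
    rw [smul_smul, mul_inv_cancel₀ hδ.ne', one_smul]
  have hi2 : IntegrableOn (fun τ => η τ • f t) (Ioi 0) := hη.smul_const _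
  have hconv : ((weighted σ fun t => δ⁻¹ * η (t / δ)) ⋆ f) t =
      ∫ τ in Ioi 0, η τ • Real.exp (-σ * (δ * τ)) • f (t - δ * τ) := by
    rw [convolution_lsmul, hfun, integral_indicator measurableSet_Ioi]
    have h4 := integral_comp_mul_left_Ioi
      (fun s => (Real.exp (-σ * s) * (δ⁻¹ * η (s / δ))) • f (t - s)) 0 hδ
    simp only [mul_zero, hcomp] at h4
    rw [integral_smul] at h4
    exact (smul_right_injective H (inv_ne_zero hδ.ne') h4).symm
  rw [hconv, ← integral_smul_const, ← integral_sub hi1 hi2]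
  refine (enorm_integral_le_lintegral_enorm _).trans_eq ?_
  refine lintegral_congr fun τ => ?_
  rw [← smul_sub, enorm_smul]

end ApproxIdentity

/-! ### Power-law kernels -/

section Kernels

variable {α σ δ : ℝ}

theorem integrable_weighted_rpow {p : ℝ} (hp : -1 < p) (hσ : 0 < σ) :
    Integrable (weighted σ fun t => t ^ p) := by
  rw [weighted, integrable_indicator_iff measurableSet_Ioi]
  refine (integrableOn_rpow_mul_exp_neg_mul_rpow hp one_pos hσ).congr_fun (fun t _ => ?_)
    measurableSet_Ioi
  simp [mul_comm]

theorem integrable_weighted_const {H : Type*} [NormedAddCommGroup H] [NormedSpace ℝ H]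
    (hσ : 0 < σ) (v : H) : Integrable (weighted σ fun _ => v) := by
  have h := (integrable_weighted_rpow (p := 0) (by norm_num) hσ).smul_const v
  refine h.congr (Eventually.of_forall fun t => ?_)
  rcases le_or_gt t 0 with ht | ht
  · simp [weighted_of_nonpos ht]
  · simp [weighted_of_pos ht]

theorem weighted_omega_eq : weighted σ (omega α) =
    fun t => (Real.Gamma α)⁻¹ * weighted σ (fun t => t ^ (α - 1)) t := by
  ext t
  rcases le_or_gt t 0 with ht | ht
  · simp [weighted_of_nonpos ht]
  · simp only [weighted_of_pos ht, omega, smul_eq_mul]; ring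

theorem integrable_weighted_omega (hα : 0 < α) (hσ : 0 < σ) :
    Integrable (weighted σ (omega α)) := by
  rw [weighted_omega_eq]
  exact (integrable_weighted_rpow (by linarith) hσ).const_mul _

theorem omega_nonneg (hα : 0 < α) {t : ℝ} (ht : 0 < t) : 0 ≤ omega α t :=
  div_nonneg (Real.rpow_nonneg ht.le _) (Real.Gamma_pos_of_pos hα).le

theorem weighted_omega_nonneg (hα : 0 < α) (t : ℝ) : 0 ≤ weighted σ (omega α) t :=
  weighted_nonneg σ (fun _ ht => omega_nonneg hα ht) t

theorem integral_weighted_omega (hα : 0 < α) (hσ : 0 < σ) :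
    ∫ t, weighted σ (omega α) t = σ ^ (-α) := by
  rw [weighted_omega_eq, integral_const_mul, weighted, integral_indicator measurableSet_Ioi]
  have h := Real.integral_rpow_mul_exp_neg_mul_Ioi hα hσ
  have h2 : ∫ t in Ioi (0:ℝ), Real.exp (-σ * t) • t ^ (α - 1) =
      (1 / σ) ^ α * Real.Gamma α := by
    rw [← h]
    congr 1
    ext t
    rw [smul_eq_mul, mul_comm, neg_mul]
  rw [h2, one_div, Real.inv_rpow hσ.le, Real.rpow_neg hσ.le]
  field_simp [(Real.Gamma_pos_of_pos hα).ne']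

/-- The derivative, up to sign, of the shifted kernel `t ↦ (t + δ)^(-α)`. -/
noncomputable def shiftedKernelDeriv (α δ t : ℝ) : ℝ := α * (t + δ) ^ (-α - 1)

/-- The profile of the approximate identity that arises when the fractional integral of order `α`
is composed with convolution by the derivative of the shifted kernel `t ↦ (t + δ)^(-α)`. -/
noncomputable def profile (α t : ℝ) : ℝ := t ^ (α - 1) / ((1 + t) * Real.Gamma α)

theorem shiftedKernelDeriv_nonneg (hα : 0 < α) (hδ : 0 < δ) {t : ℝ} (ht : 0 < t) :
    0 ≤ shiftedKernelDeriv α δ t :=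
  mul_nonneg hα.le (Real.rpow_nonneg (by linarith) _)

theorem profile_pos (hα : 0 < α) {t : ℝ} (ht : 0 < t) : 0 < profile α t := by
  have := Real.Gamma_pos_of_pos hα
  have := Real.rpow_pos_of_pos ht (α - 1)
  unfold profile
  positivity

theorem integrable_weighted_shiftedKernelDeriv (hα : 0 < α) (hσ : 0 < σ) (hδ : 0 < δ) :
    Integrable (weighted σ (shiftedKernelDeriv α δ)) := by
  refine ((integrable_weighted_const hσ (1 : ℝ)).const_mul (α * δ ^ (-α - 1))).mono' ?_ ?_
  · refine AEStronglyMeasurable.indicator ?_ measurableSet_Ioi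
    unfold shiftedKernelDeriv
    exact Measurable.aestronglyMeasurable (by fun_prop)
  · refine Eventually.of_forall fun t => ?_
    rw [Real.norm_of_nonneg (weighted_nonneg σ (fun t ht => shiftedKernelDeriv_nonneg hα hδ ht) t)]
    rcases le_or_gt t 0 with ht | ht
    · simp [weighted_of_nonpos ht]
    · simp only [weighted_of_pos ht, smul_eq_mul, shiftedKernelDeriv, mul_one]
      rw [mul_comm]
      gcongr ?_ * _
      gcongr ?_ * ?_
      exact Real.rpow_le_rpow_of_nonpos hδ (by linarith) (by linarith)

theorem integrableOn_profile (hα0 : 0 < α) (hα1 : α < 1) : IntegrableOn (profile α) (Ioi 0) := by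
  have hΓ := Real.Gamma_pos_of_pos hα0
  have hm : Measurable (profile α) := by unfold profile; fun_prop
  rw [← Ioc_union_Ioi_eq_Ioi zero_le_one]
  refine IntegrableOn.union ?_ ?_
  · have h : IntegrableOn (fun t : ℝ => t ^ (α - 1) / Real.Gamma α) (Ioc 0 1) := by
      refine Integrable.div_const ?_ _
      have := intervalIntegral.intervalIntegrable_rpow' (a := 0) (b := 1)
        (show -1 < α - 1 by linarith)
      rwa [intervalIntegrable_iff_integrableOn_Ioc_of_le zero_le_one] at this
    refine h.mono' hm.aestronglyMeasurable
      ((ae_restrict_iff' measurableSet_Ioc).2 (Eventually.of_forall fun t ht => ?_))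
    rw [Real.norm_of_nonneg (profile_pos hα0 ht.1).le, profile]
    refine div_le_div_of_nonneg_left (Real.rpow_nonneg ht.1.le _) hΓ ?_
    nlinarith [ht.1]
  · have h : IntegrableOn (fun t : ℝ => t ^ (α - 2) / Real.Gamma α) (Ioi 1) :=
      (integrableOn_Ioi_rpow_of_lt (by linarith) one_pos).div_const _
    refine h.mono' hm.aestronglyMeasurable
      ((ae_restrict_iff' measurableSet_Ioi).2 (Eventually.of_forall fun t ht => ?_))
    have ht0 : (0:ℝ) < t := lt_trans one_pos ht
    rw [Real.norm_of_nonneg (profile_pos hα0 ht0).le, profile,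
      show α - 1 = (α - 2) + 1 by ring, Real.rpow_add_one ht0.ne',
      div_le_div_iff₀ (by positivity) hΓ]
    have := Real.rpow_pos_of_pos ht0 (α - 2)
    have h3 : 0 < t ^ (α - 2) * Real.Gamma α := by positivity
    nlinarith

theorem integral_profile_pos (hα0 : 0 < α) (hα1 : α < 1) : 0 < ∫ t in Ioi 0, profile α t := by
  rw [setIntegral_pos_iff_support_of_nonneg_ae _ (integrableOn_profile hα0 hα1)]
  · have : Function.support (profile α) ∩ Ioi 0 = Ioi 0 :=
      inter_eq_right.2 fun t ht => (profile_pos hα0 ht).ne'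
    rw [this]; simp
  · exact (ae_restrict_iff' measurableSet_Ioi).2
      (Eventually.of_forall fun t ht => (profile_pos hα0 ht).le)

theorem integral_shiftedKernelDeriv_mul_omega (hα : 0 < α) (hδ : 0 < δ) {t : ℝ} (ht : 0 < t) :
    ∫ s in (0 : ℝ)..t, shiftedKernelDeriv α δ (t - s) • omega α s =
      δ ^ (-α) * omega α t - δ⁻¹ * profile α (t / δ) := by
  have hΓ := Real.Gamma_pos_of_pos hα
  have hb : 0 < t + δ := by linarith
  -- `s^α (t + δ - s)^(-α)` is a primitive of `(t + δ) α s^(α-1) (t + δ - s)^(-α-1)`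
  have hd : ∀ s ∈ Ioo 0 t, HasDerivAt (fun s : ℝ => s ^ α * (t + δ - s) ^ (-α))
      ((t + δ) * (α * s ^ (α - 1) * (t + δ - s) ^ (-α - 1))) s := by
    intro s hs
    have h0 : 0 < t + δ - s := by linarith [hs.2]
    have h1 := Real.hasDerivAt_rpow_const (p := α) (Or.inl hs.1.ne')
    have h2 := (((hasDerivAt_id s).const_sub (t + δ))).rpow_const (p := -α) (Or.inl h0.ne')
    have h3 := h1.mul h2
    refine h3.congr_deriv ?_
    have e1 : s ^ α = s ^ (α - 1) * s := by
      rw [← Real.rpow_add_one hs.1.ne']; congr 1; ring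
    have e2 : (t + δ - s) ^ (-α) = (t + δ - s) ^ (-α - 1) * (t + δ - s) := by
      rw [← Real.rpow_add_one h0.ne']; congr 1; ring
    simp only [id]
    rw [e1, e2]
    ring
  have hc : ContinuousOn (fun s : ℝ => s ^ α * (t + δ - s) ^ (-α)) (Icc 0 t) := by
    refine ContinuousOn.mul (fun s _ => (Real.continuousAt_rpow_const _ _
      (Or.inr hα.le)).continuousWithinAt) ?_
    refine ContinuousOn.rpow_const (by fun_prop) fun s hs => Or.inl ?_
    have := hs.2
    simp only [ne_eq]; linarith
  have hnn : ∀ s ∈ Ioo 0 t, 0 ≤ (t + δ) * (α * s ^ (α - 1) * (t + δ - s) ^ (-α - 1)) := by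
    intro s hs
    have h0 : 0 ≤ t + δ - s := by linarith [hs.2]
    have h1 := Real.rpow_nonneg hs.1.le (α - 1)
    have h2 := Real.rpow_nonneg h0 (-α - 1)
    positivity
  have hi := intervalIntegral.integrableOn_deriv_of_nonneg hc hd hnn
  have hF := intervalIntegral.integral_eq_sub_of_hasDerivAt_of_le ht.le hc hd
    ((intervalIntegrable_iff_integrableOn_Ioc_of_le ht.le).2 hi)
  rw [Real.zero_rpow hα.ne', zero_mul, sub_zero, intervalIntegral.integral_const_mul,
    add_sub_cancel_left] at hF
  have hL : ∫ s in (0 : ℝ)..t, shiftedKernelDeriv α δ (t - s) • omega α s =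
      (∫ s in (0 : ℝ)..t, α * s ^ (α - 1) * (t + δ - s) ^ (-α - 1)) / Real.Gamma α := by
    rw [← intervalIntegral.integral_div]
    congr 1
    ext s
    rw [shiftedKernelDeriv, omega, smul_eq_mul, show t - s + δ = t + δ - s by ring]
    ring
  rw [hL, eq_div_of_mul_eq hb.ne' ((mul_comm _ _).trans hF), profile, omega,
    Real.div_rpow ht.le hδ.le]
  have e1 : t ^ α = t ^ (α - 1) * t := by
    rw [← Real.rpow_add_one ht.ne']; congr 1; ring
  have e2 : δ ^ (α - 1) = (δ ^ (-α))⁻¹ * δ⁻¹ := by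
    rw [Real.rpow_neg hδ.le, inv_inv, Real.rpow_sub_one hδ.ne', div_eq_mul_inv]
  have h4 := Real.rpow_pos_of_pos hδ (-α)
  rw [e1, e2]
  field_simp
  ring

theorem weighted_scaled_profile_eq (hα : 0 < α) (hδ : 0 < δ) :
    (weighted σ fun t => δ⁻¹ * profile α (t / δ)) =
      (δ ^ (-α)) • weighted σ (omega α)
        - weighted σ (shiftedKernelDeriv α δ) ⋆ weighted σ (omega α) := by
  rw [weighted_convolution]
  ext t
  rw [Pi.sub_apply, Pi.smul_apply]
  rcases le_or_gt t 0 with ht | ht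
  · simp [weighted_of_nonpos ht]
  · simp only [weighted_of_pos ht]
    rw [integral_shiftedKernelDeriv_mul_omega hα hδ ht]
    simp only [smul_eq_mul]
    ring

theorem integrable_weighted_scaled_profile (hα : 0 < α) (hσ : 0 < σ) (hδ : 0 < δ) :
    Integrable (weighted σ fun t => δ⁻¹ * profile α (t / δ)) := by
  rw [weighted_scaled_profile_eq hα hδ]
  have h := integrable_weighted_omega hα hσ
  exact (h.smul _).sub ((integrable_weighted_shiftedKernelDeriv hα hσ hδ).integrable_convolution _ h)

/-- The convolution of `t^(-α)` with the kernel of the fractional integral of order `α` is a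
positive constant (a value of the Beta function). -/
theorem exists_convolution_rpow_omega (hα0 : 0 < α) (hα1 : α < 1) (hσ : 0 < σ) :
    ∃ B : ℝ, 0 < B ∧ (weighted σ fun t => t ^ (-α)) ⋆ weighted σ (omega α) =
      B • weighted σ fun _ => (1 : ℝ) := by
  set B := ∫ s in (0 : ℝ)..1, (1 - s) ^ (-α) * omega α s with hB
  have heq : (weighted σ fun t => t ^ (-α)) ⋆ weighted σ (omega α) =
      B • weighted σ fun _ => (1 : ℝ) := by
    rw [weighted_convolution]
    ext t
    rw [Pi.smul_apply]
    rcases le_or_gt t 0 with ht | ht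
    · simp [weighted_of_nonpos ht]
    · have h1 := intervalIntegral.integral_comp_mul_left (a := 0) (b := 1)
        (fun s => (t - s) ^ (-α) • omega α s) ht.ne'
      have h2 : ∀ x ∈ uIcc (0:ℝ) 1, (t - t * x) ^ (-α) • omega α (t * x) =
          t⁻¹ * ((1 - x) ^ (-α) * omega α x) := by
        intro x hx
        rw [uIcc_of_le zero_le_one] at hx
        rw [show t - t * x = t * (1 - x) by ring, Real.mul_rpow ht.le (by linarith [hx.2]),
          omega, omega, Real.mul_rpow ht.le hx.1, Real.rpow_sub_one ht.ne', Real.rpow_neg ht.le,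
          smul_eq_mul]
        have := Real.rpow_pos_of_pos ht α
        field_simp
      rw [intervalIntegral.integral_congr h2, intervalIntegral.integral_const_mul, mul_zero,
        mul_one, ← hB, smul_eq_mul] at h1
      have h3 := mul_left_cancel₀ (inv_ne_zero ht.ne') h1
      simp only [weighted_of_pos ht]
      rw [← h3]
      simp [mul_comm]
  refine ⟨B, ?_, heq⟩
  have hk := integrable_weighted_rpow (p := -α) (by linarith) hσ
  have h4 := integral_convolution_real hk (integrable_weighted_omega hα0 hσ)
  rw [heq, integral_weighted_omega hα0 hσ] at h4
  simp only [Pi.smul_apply, smul_eq_mul] at h4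
  rw [integral_const_mul] at h4
  have h5 : 0 < ∫ t, weighted σ (fun t => t ^ (-α)) t := by
    have := integral_weighted_omega (α := 1 - α) (σ := σ) (by linarith) hσ
    rw [weighted_omega_eq, integral_const_mul] at this
    have h6 : (1 - α - 1) = -α := by ring
    rw [h6] at this
    have h7 := Real.Gamma_pos_of_pos (show 0 < 1 - α by linarith)
    have h8 := Real.rpow_pos_of_pos hσ (-(1 - α))
    rw [← this] at h8
    exact (pos_iff_pos_of_mul_pos h8).1 (inv_pos.2 h7)
  have h9 : 0 < B * ∫ t, weighted σ (fun _ => (1:ℝ)) t := by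
    rw [h4]; exact mul_pos h5 (Real.rpow_pos_of_pos hσ _)
  have h10 : 0 ≤ ∫ t, weighted σ (fun _ => (1:ℝ)) t :=
    integral_nonneg fun t => weighted_nonneg σ (fun _ _ => zero_le_one) t
  exact (pos_iff_pos_of_mul_pos h9).2 (h10.lt_of_ne' (right_ne_zero_of_mul h9.ne'))

end Kernels

/-! ### Accretivity of the fractional derivative in `L¹` -/

section Accretivity

/-- A function bounded above by functions that tend to `0` in `L¹` is nonpositive. -/
theorem ae_nonpos_of_tendsto_lintegral {ι : Type*} {l : Filter ι} [l.NeBot] {g : ℝ → ℝ}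
    {e : ι → ℝ → ℝ} (hg : AEMeasurable g) (h : ∀ᶠ i in l, g ≤ᵐ[volume] e i)
    (he : Tendsto (fun i => ∫⁻ t, ‖e i t‖ₑ) l (𝓝 0)) : ∀ᵐ t, g t ≤ 0 := by
  have h0 : ∫⁻ t, ENNReal.ofReal (g t) ≤ 0 := by
    refine ge_of_tendsto he ?_
    filter_upwards [h] with i hi
    refine lintegral_mono_ae ?_
    filter_upwards [hi] with t ht
    rw [← ofReal_norm]
    exact ENNReal.ofReal_le_ofReal (ht.trans (Real.le_norm_self _))
  have h1 := (lintegral_eq_zero_iff' hg.ennreal_ofReal).1 (le_antisymm h0 zero_le)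
  filter_upwards [h1] with t ht
  exact ENNReal.ofReal_eq_zero.1 ht

theorem lintegral_enorm_convolution_le {k e : ℝ → ℝ} (hk : Integrable k) (he : Integrable e) :
    ∫⁻ t, ‖(k ⋆ e) t‖ₑ ≤ ENNReal.ofReal (∫ t, ‖k t‖) * ∫⁻ t, ‖e t‖ₑ := by
  rw [← ofReal_integral_norm_eq_lintegral_enorm (hk.integrable_convolution _ he),
    ← ofReal_integral_norm_eq_lintegral_enorm he,
    ← ENNReal.ofReal_mul (integral_nonneg fun _ => norm_nonneg _)]
  refine ENNReal.ofReal_le_ofReal ?_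
  rw [← integral_convolution_real hk.norm he.norm]
  refine integral_mono (hk.integrable_convolution _ he).norm
    (hk.norm.integrable_convolution _ he.norm) fun t => ?_
  simp only [convolution_def, ContinuousLinearMap.lsmul_apply, smul_eq_mul]
  refine (norm_integral_le_integral_norm _).trans_eq ?_
  simp only [norm_mul]

variable {H : Type*} [NormedAddCommGroup H] [InnerProductSpace ℝ H] [CompleteSpace H]
  {α σ c : ℝ} {f w : ℝ → H} {u₀ : H}

/-- Testing with `w / ‖w‖`: since the shifted kernel `(t + δ)^(-α)` is decreasing and finite
at `0`, the norm can be taken under the regularized fractional derivative.  The term `J f` is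
inserted because the approximate identity has total mass `J` in the limit `δ → 0`. -/
theorem shifted_norm_le (hα0 : 0 < α) (hσ : 0 < σ) (hf : Integrable f)
    (hw : w =ᵐ[volume] fun t => weighted σ (omega α) t • u₀ + (weighted σ (omega α) ⋆ f) t)
    (hfw : ∀ᵐ t, inner ℝ (f t) (w t) ≤ c * ‖w t‖ ^ 2) {δ J : ℝ} (hδ : 0 < δ) (hJ : 0 ≤ J) :
    ∀ᵐ t, δ ^ (-α) * ‖w t‖ - (weighted σ (shiftedKernelDeriv α δ) ⋆ fun s => ‖w s‖) t ≤
      weighted σ (fun t => δ⁻¹ * profile α (t / δ)) t * ‖u₀‖ +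
      ‖((weighted σ fun t => δ⁻¹ * profile α (t / δ)) ⋆ f) t - J • f t‖ + J * c * ‖w t‖ := by
  set κ := weighted σ (shiftedKernelDeriv α δ) with hκ
  set om := weighted σ (omega α) with hom
  set h := weighted σ fun t => δ⁻¹ * profile α (t / δ) with hh
  have hκi : Integrable κ := integrable_weighted_shiftedKernelDeriv hα0 hσ hδ
  have homi : Integrable om := integrable_weighted_omega hα0 hσ
  have hκ0 : ∀ t, 0 ≤ κ t := weighted_nonneg σ fun t ht => shiftedKernelDeriv_nonneg hα0 hδ ht
  have hh0 : ∀ t, 0 ≤ h t := weighted_nonneg σ fun t ht =>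
    mul_nonneg (inv_pos.2 hδ).le (profile_pos hα0 (div_pos ht hδ)).le
  have hheq : h = δ ^ (-α) • om - κ ⋆ om := weighted_scaled_profile_eq hα0 hδ
  have hconv : κ ⋆ w = κ ⋆ ((fun t => om t • u₀) + om ⋆ f) := convolution_ae_congr hw
  have h1 := convolution_add_ae hκi (homi.smul_const u₀) (homi.integrable_convolution
    (ContinuousLinearMap.lsmul ℝ ℝ) hf)
  have h2 := convolution_assoc_ae hκi homi hf
  have h3 := sub_convolution_ae (homi.smul (δ ^ (-α)))
    (hκi.integrable_convolution (ContinuousLinearMap.lsmul ℝ ℝ) homi) hf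
  rw [← hheq] at h3
  filter_upwards [hw, hfw, h1, h2, h3] with t hwt hfwt h1t h2t h3t
  rw [smul_convolution] at h3t
  rw [← hconv, convolution_smul_const] at h1t
  simp only [Pi.add_apply, Pi.sub_apply, Pi.smul_apply] at h1t h3t
  have hht : h t = δ ^ (-α) * om t - (κ ⋆ om) t := by rw [hheq]; rfl
  have hid : δ ^ (-α) • w t - (κ ⋆ w) t = h t • u₀ + (h ⋆ f) t := by
    rw [h3t, h1t, h2t, hht, hwt, smul_add, sub_smul, mul_smul]
    abel
  have hκw : ‖(κ ⋆ w) t‖ ≤ (κ ⋆ fun s => ‖w s‖) t := norm_convolution_le hκ0 w t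
  have hprod : (δ ^ (-α) * ‖w t‖ - (κ ⋆ fun s => ‖w s‖) t) * ‖w t‖ ≤
      (h t * ‖u₀‖ + ‖(h ⋆ f) t - J • f t‖ + J * c * ‖w t‖) * ‖w t‖ := by
    have e1 : inner ℝ (δ ^ (-α) • w t - (κ ⋆ w) t) (w t) =
        δ ^ (-α) * ‖w t‖ ^ 2 - inner ℝ ((κ ⋆ w) t) (w t) := by
      rw [inner_sub_left, real_inner_smul_left, real_inner_self_eq_norm_sq]
    have e2 : inner ℝ (h t • u₀ + (h ⋆ f) t) (w t) = h t * inner ℝ u₀ (w t) +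
        inner ℝ ((h ⋆ f) t - J • f t) (w t) + J * inner ℝ (f t) (w t) := by
      rw [inner_add_left, real_inner_smul_left, inner_sub_left, real_inner_smul_left]
      ring
    have e3 := real_inner_le_norm ((κ ⋆ w) t) (w t)
    have e4 := mul_le_mul_of_nonneg_left (real_inner_le_norm u₀ (w t)) (hh0 t)
    have e5 := real_inner_le_norm ((h ⋆ f) t - J • f t) (w t)
    have e6 := mul_le_mul_of_nonneg_left hfwt hJ
    have e7 := mul_le_mul_of_nonneg_right hκw (norm_nonneg (w t))
    rw [hid] at e1
    nlinarith
  rcases (norm_nonneg (w t)).eq_or_lt with h0 | h0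
  · rw [← h0]
    have := convolution_nonneg hκ0 (fun s => norm_nonneg (w s)) t
    have := mul_nonneg (hh0 t) (norm_nonneg u₀)
    have := norm_nonneg ((h ⋆ f) t - J • f t)
    simp only [mul_zero]
    linarith
  · exact le_of_mul_le_mul_right hprod h0

/-- If `w` is the solution of the fractional evolution equation `∂ₜ I^(1-α) w = f`,
`(I^(1-α) w)(0) = u₀`, with a forcing `f` satisfying the one-sided bound `⟨f, w⟩ ≤ c ‖w‖²`, then
`‖w‖` is a subsolution of the scalar equation `∂ₜ I^(1-α) y = c y` with initial value `‖u₀‖`. -/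
theorem norm_le_omega_add_convolution (hα0 : 0 < α) (hα1 : α < 1) (hσ : 0 < σ)
    (hf : Integrable f)
    (hw : w =ᵐ[volume] fun t => weighted σ (omega α) t • u₀ + (weighted σ (omega α) ⋆ f) t)
    (hfw : ∀ᵐ t, inner ℝ (f t) (w t) ≤ c * ‖w t‖ ^ 2) :
    ∀ᵐ t, ‖w t‖ ≤ weighted σ (omega α) t * ‖u₀‖ +
      c * (weighted σ (omega α) ⋆ fun s => ‖w s‖) t := by
  set om := weighted σ (omega α) with hom
  set J := ∫ t in Ioi 0, profile α t with hJdef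
  set h : ℝ → ℝ → ℝ := fun δ => weighted σ fun t => δ⁻¹ * profile α (t / δ) with hh
  set y : ℝ → ℝ := fun t => ‖w t‖ with hy
  have hJ : 0 < J := integral_profile_pos hα0 hα1
  have homi : Integrable om := integrable_weighted_omega hα0 hσ
  have hom0 : ∀ t, 0 ≤ om t := weighted_omega_nonneg hα0
  have hwi : Integrable w := by
    refine Integrable.congr ?_ hw.symm
    exact (homi.smul_const u₀).add (homi.integrable_convolution _ hf)
  have hyi : Integrable y := hwi.norm
  have homy : Integrable (om ⋆ y) := homi.integrable_convolution _ hyi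
  have hhi : ∀ δ, 0 < δ → Integrable (h δ) := fun δ hδ =>
    integrable_weighted_scaled_profile hα0 hσ hδ
  have hη := integrableOn_profile hα0 hα1
  have lf := tendsto_lintegral_weighted_scaled_convolution_sub hη hσ.le hf hhi
  have ly := tendsto_lintegral_weighted_scaled_convolution_sub hη hσ.le hyi hhi
  have lo := tendsto_lintegral_weighted_scaled_convolution_sub hη hσ.le homi hhi
  let e : ℝ → ℝ → ℝ := fun δ t => ‖(h δ ⋆ f) t - J • f t‖
  have hei : ∀ δ, 0 < δ → Integrable (e δ) := fun δ hδ =>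
    (((hhi δ hδ).integrable_convolution _ hf).sub (hf.smul J)).norm
  let E : ℝ → ℝ → ℝ := fun δ t => ‖(h δ ⋆ y) t - J • y t‖ + ‖u₀‖ * ‖(h δ ⋆ om) t - J • om t‖
    + (om ⋆ e δ) t
  have hE : Tendsto (fun δ => ∫⁻ t, ‖E δ t‖ₑ) (𝓝[>] 0) (𝓝 0) := by
    have hlim := (ly.add (ENNReal.Tendsto.const_mul lo
      (Or.inr (enorm_ne_top (x := ‖u₀‖))))).add
      (ENNReal.Tendsto.const_mul lf (Or.inr (ENNReal.ofReal_ne_top (r := ∫ t, ‖om t‖))))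
    simp only [mul_zero, add_zero] at hlim
    refine tendsto_of_tendsto_of_tendsto_of_le_of_le' tendsto_const_nhds hlim
      (Eventually.of_forall fun _ => zero_le) ?_
    filter_upwards [self_mem_nhdsWithin] with δ hδ
    have m1 : AEMeasurable fun t => ‖(h δ ⋆ y) t - J • y t‖ₑ :=
      (((hhi δ hδ).integrable_convolution _ hyi).sub (hyi.smul J)).aestronglyMeasurable.enorm
    have m2 : AEMeasurable fun t => ‖(h δ ⋆ om) t - J • om t‖ₑ :=
      (((hhi δ hδ).integrable_convolution _ homi).sub (homi.smul J)).aestronglyMeasurable.enorm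
    have m3 : AEMeasurable fun t => ‖(h δ ⋆ y) t - J • y t‖ₑ +
        ‖‖u₀‖‖ₑ * ‖(h δ ⋆ om) t - J • om t‖ₑ := m1.add (m2.const_mul _)
    have b := lintegral_enorm_convolution_le homi (hei δ hδ)
    simp only [e, enorm_norm] at b
    refine le_trans ?_ (add_le_add_right b _)
    rw [← lintegral_const_mul'' _ m2, ← lintegral_add_left' m1,
      ← lintegral_add_left' m3]
    refine lintegral_mono fun t => ?_
    refine (enorm_add_le _ _).trans ?_
    gcongr
    refine (enorm_add_le _ _).trans ?_
    simp only [enorm_mul, enorm_norm, le_refl]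
  have hmain : ∀ᵐ t, J * (y t - om t * ‖u₀‖ - c * (om ⋆ y) t) ≤ 0 := by
    refine ae_nonpos_of_tendsto_lintegral (l := 𝓝[>] (0:ℝ)) (e := E) ?_ ?_ hE
    · exact (((hyi.sub (homi.mul_const _)).sub (homy.const_mul c)).const_mul J).aemeasurable
    filter_upwards [self_mem_nhdsWithin] with δ hδ
    rw [mem_Ioi] at hδ
    set κ := weighted σ (shiftedKernelDeriv α δ) with hκ
    have hκi : Integrable κ := integrable_weighted_shiftedKernelDeriv hα0 hσ hδ
    have hheq : h δ = δ ^ (-α) • om - κ ⋆ om := weighted_scaled_profile_eq hα0 hδ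
    have hκy : Integrable (κ ⋆ y) := hκi.integrable_convolution _ hyi
    have p1 := shifted_norm_le hα0 hσ hf hw hfw hδ hJ.le
    have p2 : om ⋆ (δ ^ (-α) • y - κ ⋆ y) ≤ᵐ[volume]
        om ⋆ ((fun t => h δ t * ‖u₀‖) + e δ + (J * c) • y) := by
      refine convolution_mono_ae homi hom0 ((hyi.smul _).sub hκy)
        ((((hhi δ hδ).mul_const _).add (hei δ hδ)).add (hyi.smul _)) ?_
      filter_upwards [p1] with t ht
      exact ht
    have q1 := convolution_sub_ae homi (hyi.smul (δ ^ (-α))) hκy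
    have q2 := convolution_assoc_ae homi hκi hyi
    have q3 := sub_convolution_ae (homi.smul (δ ^ (-α))) (hκi.integrable_convolution
      (ContinuousLinearMap.lsmul ℝ ℝ) homi) hyi
    rw [← hheq] at q3
    have q4 := convolution_add_ae homi (((hhi δ hδ).mul_const ‖u₀‖).add (hei δ hδ))
      (hyi.smul (J * c))
    have q5 := convolution_add_ae homi ((hhi δ hδ).mul_const ‖u₀‖) (hei δ hδ)
    have q6 : (om ⋆ fun t => h δ t * ‖u₀‖) = fun t => (om ⋆ h δ) t * ‖u₀‖ :=
      convolution_smul_const om (h δ) ‖u₀‖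
    rw [q6] at q5
    rw [convolution_smul] at q1 q4
    rw [smul_convolution, convolution_comm_real κ om] at q3
    filter_upwards [p2, q1, q2, q3, q4, q5] with t p2 q1 q2 q3 q4 q5
    rw [q4, q1] at p2
    simp only [Pi.add_apply, Pi.sub_apply, Pi.smul_apply, smul_eq_mul] at p2 q3 q5
    rw [← q2, ← q3, q5, convolution_comm_real om (h δ)] at p2
    have r1 := neg_le_of_abs_le (le_refl |(h δ ⋆ y) t - J • y t|)
    have r2 := mul_le_mul_of_nonneg_left (le_abs_self ((h δ ⋆ om) t - J • om t)) (norm_nonneg u₀)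
    simp only [E, Real.norm_eq_abs]
    simp only [smul_eq_mul] at *
    nlinarith
  filter_upwards [hmain] with t ht
  have := (mul_nonpos_iff_pos_imp_nonpos.1 ht).1 hJ
  linarith

/-- `L¹`-form of the Gronwall inequality for a convolution kernel of small mass. -/
theorem integral_le_of_le_add_convolution {k g y : ℝ → ℝ} (hk : Integrable k) (hg : Integrable g)
    (hy : Integrable y) (hy0 : ∀ t, 0 ≤ y t) (hkc : c * ∫ t, k t ≤ 1 / 2)
    (h : ∀ᵐ t, y t ≤ g t + c * (k ⋆ y) t) : ∫ t, y t ≤ 2 * ∫ t, g t := by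
  have hky : Integrable (k ⋆ y) := hk.integrable_convolution _ hy
  have h1 := integral_mono_ae hy (hg.add (hky.const_mul c)) h
  have h2 : ∫ t, (g + fun t => c * (k ⋆ y) t) t = (∫ t, g t) + c * ((∫ t, k t) * ∫ t, y t) := by
    rw [← integral_convolution_real hk hy, ← integral_const_mul]
    exact integral_add hg (hky.const_mul c)
  rw [h2] at h1
  have h3 := mul_le_mul_of_nonneg_right hkc (integral_nonneg hy0 : 0 ≤ ∫ t, y t)
  nlinarith

/-- Stability of the solution `u = u₀ + ∫ φ` of the evolution equation
`u' = φ`, `w = ∂ₜ^(1-α) u`, when `⟨φ, w⟩ ≤ c ‖w‖²`. -/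
theorem exp_mul_norm_le_two_mul (hα0 : 0 < α) (hα1 : α < 1) (hσ : 0 < σ) (hc : 0 ≤ c)
    (hcσ : c * σ ^ (-α) ≤ 1 / 2) {φ : ℝ → H} (hf : Integrable (weighted σ φ))
    (hw : w =ᵐ[volume] fun t =>
      weighted σ (omega α) t • u₀ + (weighted σ (omega α) ⋆ weighted σ φ) t)
    (hfw : ∀ᵐ t, inner ℝ (weighted σ φ t) (w t) ≤ c * ‖w t‖ ^ 2) :
    ∀ᵐ t, 0 < t → Real.exp (-σ * t) * ‖u₀ + ∫ s in (0 : ℝ)..t, φ s‖ ≤ 2 * ‖u₀‖ := by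
  set om := weighted σ (omega α) with hom
  set y : ℝ → ℝ := fun t => ‖w t‖ with hy
  have homi : Integrable om := integrable_weighted_omega hα0 hσ
  have hofi := homi.integrable_convolution (ContinuousLinearMap.lsmul ℝ ℝ) hf
  have hwi : Integrable w := by
    refine Integrable.congr ?_ hw.symm
    exact (homi.smul_const u₀).add hofi
  have hyi : Integrable y := hwi.norm
  have homy : Integrable (om ⋆ y) := homi.integrable_convolution _ hyi
  have hle := norm_le_omega_add_convolution hα0 hα1 hσ hf hw hfw
  have hyint : c * ∫ t, y t ≤ ‖u₀‖ := by
    have h1 := integral_le_of_le_add_convolution (c := c) homi (homi.mul_const ‖u₀‖) hyi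
      (fun t => norm_nonneg _) (by rw [integral_weighted_omega hα0 hσ]; exact hcσ) hle
    rw [integral_mul_const, integral_weighted_omega hα0 hσ] at h1
    have h2 := mul_le_mul_of_nonneg_left h1 hc
    have h3 := mul_le_mul_of_nonneg_right hcσ (norm_nonneg u₀)
    nlinarith
  obtain ⟨B, hB, hkB⟩ := exists_convolution_rpow_omega hα0 hα1 hσ
  set k := weighted σ fun t : ℝ => t ^ (-α) with hk
  have hki : Integrable k := integrable_weighted_rpow (by linarith) hσ
  have hk0 : ∀ t, 0 ≤ k t := weighted_nonneg σ fun t ht => Real.rpow_nonneg ht.le _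
  set E := weighted σ fun _ => (1 : ℝ) with hE
  have hEi : Integrable E := integrable_weighted_const hσ 1
  have hE0 : ∀ t, 0 ≤ E t := weighted_nonneg σ fun _ _ => zero_le_one
  have hE1 : ∀ t, E t ≤ 1 := by
    intro t
    rcases le_or_gt t 0 with ht | ht
    · simp [hE, weighted_of_nonpos ht]
    · rw [hE, weighted_of_pos ht, smul_eq_mul, mul_one]
      exact Real.exp_le_one_iff.2 (by nlinarith)
  -- convolving with `t^(-α)` recovers `u` from `w`
  have a1 : k ⋆ w = k ⋆ ((fun t => om t • u₀) + om ⋆ weighted σ φ) := convolution_ae_congr hw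
  have a2 := convolution_add_ae hki (homi.smul_const u₀) hofi
  rw [← a1, convolution_smul_const, hkB] at a2
  have a3 := convolution_assoc_ae hki homi hf
  rw [hkB, smul_convolution] at a3
  have b1 := convolution_mono_ae hki hk0 hyi ((homi.mul_const ‖u₀‖).add (homy.const_mul c)) hle
  have b2 := convolution_add_ae hki (homi.mul_const ‖u₀‖) (homy.const_mul c)
  have b3 : (k ⋆ fun t => om t * ‖u₀‖) = fun t => (k ⋆ om) t * ‖u₀‖ :=
    convolution_smul_const k om ‖u₀‖
  have b4 : (k ⋆ fun t => c * (om ⋆ y) t) = c • (k ⋆ (om ⋆ y)) := convolution_smul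
  have b5 := convolution_assoc_ae hki homi hyi
  rw [b3, b4, hkB] at b2
  rw [hkB, smul_convolution] at b5
  filter_upwards [a2, a3, b1, b2, b5] with t a2 a3 b1 b2 b5 ht
  have n1 := (norm_convolution_le hk0 w t).trans b1
  rw [b2, a2] at n1
  simp only [Pi.add_apply, Pi.smul_apply, smul_eq_mul] at n1 a3 b5
  rw [← a3, ← b5, weighted_convolution] at n1
  have hEt : E t = Real.exp (-σ * t) := by rw [hE, weighted_of_pos ht, smul_eq_mul, mul_one]
  have hEy : (E ⋆ y) t ≤ ∫ s, y s := by
    rw [convolution_lsmul_swap]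
    refine integral_mono_of_nonneg (Eventually.of_forall fun s => ?_) hyi
      (Eventually.of_forall fun s => ?_)
    · exact mul_nonneg (hE0 _) (norm_nonneg _)
    · exact mul_le_of_le_one_left (norm_nonneg _) (hE1 _)
  rw [weighted_of_pos ht, mul_smul, ← smul_add, norm_smul, Real.norm_of_nonneg hB.le, hEt] at n1
  simp only [one_smul] at n1
  rw [← smul_add, norm_smul, Real.norm_of_nonneg (Real.exp_pos _).le] at n1
  have n2 : B * (Real.exp (-σ * t) * ‖u₀ + ∫ s in (0 : ℝ)..t, φ s‖) ≤
      B * (Real.exp (-σ * t) * ‖u₀‖ + c * (E ⋆ y) t) := by linarith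
  have n3 := le_of_mul_le_mul_left n2 hB
  have n4 := mul_le_mul_of_nonneg_left hEy hc
  have n5 : Real.exp (-σ * t) * ‖u₀‖ ≤ ‖u₀‖ :=
    mul_le_of_le_one_left (norm_nonneg _) (hEt ▸ hE1 t)
  linarith

end Accretivity

/-! ### The Riemann–Liouville derivative of a locally absolutely continuous function -/

section FractionalDerivative

variable {α : ℝ}

theorem intervalIntegrable_omega (hα : 0 < α) (a b : ℝ) :
    IntervalIntegrable (omega α) volume a b := by
  unfold omega
  exact (intervalIntegral.intervalIntegrable_rpow' (by linarith)).div_const _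

theorem intervalIntegrable_omega_sub (hα : 0 < α) (t a b : ℝ) :
    IntervalIntegrable (fun s => omega α (t - s)) volume a b := by
  have h := (intervalIntegrable_omega hα (t - a) (t - b)).comp_sub_left t (by finiteness)
  simpa using h

theorem integral_omega_sub (hα : 0 < α) (t : ℝ) :
    ∫ s in (0 : ℝ)..t, omega α (t - s) = t ^ α / (α * Real.Gamma α) := by
  rw [intervalIntegral.integral_comp_sub_left (omega α) t]
  simp only [sub_self, sub_zero, omega]
  rw [intervalIntegral.integral_div, integral_rpow (Or.inl (by linarith))]
  simp only [sub_add_cancel, Real.zero_rpow hα.ne', sub_zero]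
  rw [div_div]

theorem hasDerivAt_omega {t : ℝ} (ht : 0 < t) :
    HasDerivAt (omega α) ((α - 1) * t ^ (α - 2) / Real.Gamma α) t := by
  have h := (Real.hasDerivAt_rpow_const (p := α - 1) (Or.inl ht.ne')).div_const (Real.Gamma α)
  rw [show α - 1 - 1 = α - 2 by ring] at h
  exact h

theorem measurable_omega : Measurable (omega α) := by
  unfold omega
  fun_prop

/-- Fractional and ordinary integration commute. -/
theorem integral_omega_smul_integral (hα : 0 < α) {f : ℝ → ℝ}
    (hf : Integrable (weighted 1 f)) {t : ℝ} (ht : 0 < t) :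
    ∫ s in (0 : ℝ)..t, omega α (t - s) • ∫ r in (0 : ℝ)..s, f r =
      ∫ s in (0 : ℝ)..t, ∫ r in (0 : ℝ)..s, omega α (s - r) • f r := by
  have hE : Integrable (weighted 1 fun _ => (1 : ℝ)) := integrable_weighted_const one_pos 1
  have ho : Integrable (weighted 1 (omega α)) := integrable_weighted_omega hα one_pos
  have hE1 : ∀ t, ‖weighted 1 (fun _ => (1 : ℝ)) t‖ ≤ 1 := by
    intro t
    rcases le_or_gt t 0 with ht | ht
    · simp [weighted_of_nonpos ht]
    · rw [weighted_of_pos ht, smul_eq_mul, mul_one, Real.norm_of_nonneg (Real.exp_pos _).le]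
      exact Real.exp_le_one_iff.2 (by linarith)
  have hEf := hE.norm.integrable_convolution (ContinuousLinearMap.mul ℝ ℝ) hf.norm
  have hof := ho.norm.integrable_convolution (ContinuousLinearMap.mul ℝ ℝ) hf.norm
  have key : (weighted 1 (omega α) ⋆ (weighted 1 (fun _ => (1 : ℝ)) ⋆ weighted 1 f)) t =
      (weighted 1 (fun _ => (1 : ℝ)) ⋆ (weighted 1 (omega α) ⋆ weighted 1 f)) t := by
    rw [← convolution_assoc (ContinuousLinearMap.lsmul ℝ ℝ) (ContinuousLinearMap.lsmul ℝ ℝ)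
        (ContinuousLinearMap.lsmul ℝ ℝ) (ContinuousLinearMap.lsmul ℝ ℝ) (fun x y z => mul_smul x y z)
        ho.aestronglyMeasurable hE.aestronglyMeasurable hf.aestronglyMeasurable
        (ho.ae_convolution_exists _ hE) (hE.norm.ae_convolution_exists _ hf.norm),
      ← convolution_assoc (ContinuousLinearMap.lsmul ℝ ℝ) (ContinuousLinearMap.lsmul ℝ ℝ)
        (ContinuousLinearMap.lsmul ℝ ℝ) (ContinuousLinearMap.lsmul ℝ ℝ) (fun x y z => mul_smul x y z)
        hE.aestronglyMeasurable ho.aestronglyMeasurable hf.aestronglyMeasurable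
        (hE.ae_convolution_exists _ ho) (ho.norm.ae_convolution_exists _ hf.norm),
      convolution_comm_real (weighted 1 (omega α))]
    · exact (hof.comp_sub_left t).bdd_mul (c := 1) hE.aestronglyMeasurable.norm
        (Eventually.of_forall fun s => by rw [norm_norm]; exact hE1 s)
    · refine ho.norm.mul_bdd (c := ∫ s, ‖weighted 1 f s‖) (hEf.comp_sub_left t).aestronglyMeasurable
        (Eventually.of_forall fun s => ?_)
      rw [convolution_mul_swap]
      refine (norm_integral_le_integral_norm _).trans ?_
      refine integral_mono_of_nonneg (Eventually.of_forall fun _ => norm_nonneg _) hf.norm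
        (Eventually.of_forall fun r => ?_)
      simp only [norm_mul, norm_norm]
      exact mul_le_of_le_one_left (norm_nonneg _) (hE1 _)
  rw [weighted_convolution, weighted_convolution, weighted_convolution, weighted_convolution,
    weighted_of_pos ht, weighted_of_pos ht] at key
  have := smul_right_injective ℝ (Real.exp_pos (-1 * t)).ne' key
  simpa using this

/-- The contribution of the history on `[0, ε]` to the fractional derivative at `t > ε`.  The
derivative of `ω_α` has constant sign, which turns the bound on `g` into `η ω_α(t - ε)`. -/
theorem hasDerivAt_history {g : ℝ → ℝ} {ε η : ℝ} (hα0 : 0 < α) (hα1 : α < 1) (hε : 0 < ε)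
    (hg : ContinuousOn g (Icc 0 ε)) (hgη : ∀ s ∈ Icc 0 ε, |g s| ≤ η) {t : ℝ} (ht : ε < t) :
    ∃ q : ℝ, |q| ≤ η * omega α (t - ε) ∧
      HasDerivAt (fun t => ∫ s in (0 : ℝ)..ε, omega α (t - s) • g s) q t := by
  have hΓ := Real.Gamma_pos_of_pos hα0
  have hη : 0 ≤ η := (abs_nonneg _).trans (hgη 0 ⟨le_rfl, hε.le⟩)
  have hgm : AEStronglyMeasurable g (volume.restrict (uIoc 0 ε)) := by
    rw [uIoc_of_le hε.le]
    exact (hg.mono Ioc_subset_Icc_self).aestronglyMeasurable measurableSet_Ioc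
  set F' : ℝ → ℝ → ℝ := fun t s => ((α - 1) * (t - s) ^ (α - 2) / Real.Gamma α) * g s with hF'
  set a := (t - ε) / 2 with ha
  have ha0 : 0 < a := by rw [ha]; linarith
  have hd := intervalIntegral.hasDerivAt_integral_of_dominated_loc_of_deriv_le (μ := volume)
    (F := fun t s => omega α (t - s) • g s) (F' := F') (x₀ := t) (a := 0) (b := ε)
    (s := Ioi (ε + a)) (bound := fun _ => ((1 - α) * a ^ (α - 2) / Real.Gamma α) * η)
    (Ioi_mem_nhds (by rw [ha]; linarith))
    (Eventually.of_forall fun x => ((measurable_omega.comp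
      (measurable_const.sub measurable_id)).aestronglyMeasurable).mul hgm)
    (by
      refine (intervalIntegrable_omega_sub hα0 t 0 ε).mul_continuousOn ?_
      rwa [uIcc_of_le hε.le])
    ((Measurable.aestronglyMeasurable (by fun_prop)).mul hgm)
    (Eventually.of_forall fun s hs x hx => by
      rw [uIoc_of_le hε.le] at hs
      have hxs : a ≤ x - s := by
        have := mem_Ioi.1 hx
        linarith [hs.2]
      simp only [hF', norm_mul, Real.norm_eq_abs]
      refine mul_le_mul ?_ (hgη s ⟨hs.1.le, hs.2⟩) (abs_nonneg _) (by
        have := Real.rpow_nonneg ha0.le (α - 2)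
        have : 0 ≤ 1 - α := by linarith
        positivity)
      rw [abs_div, abs_mul, abs_of_pos hΓ, abs_of_neg (by linarith : α - 1 < 0), neg_sub,
        abs_of_nonneg (Real.rpow_nonneg (ha0.le.trans hxs) _)]
      have : 0 ≤ 1 - α := by linarith
      gcongr ?_ * ?_ / _
      exact Real.rpow_le_rpow_of_nonpos ha0 hxs (by linarith))
    intervalIntegrable_const
    (Eventually.of_forall fun s hs x hx => by
      rw [uIoc_of_le hε.le] at hs
      have hxs : 0 < x - s := by
        have := mem_Ioi.1 hx
        linarith [hs.2]
      have h1 := (hasDerivAt_omega (α := α) hxs).comp x ((hasDerivAt_id x).sub_const s)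
      rw [mul_one] at h1
      exact h1.mul_const (g s))
  refine ⟨_, ?_, hd.2⟩
  have hD : ∀ s ∈ uIcc 0 ε, HasDerivAt (fun s => omega α (t - s))
      ((1 - α) * (t - s) ^ (α - 2) / Real.Gamma α) s := by
    intro s hs
    rw [uIcc_of_le hε.le] at hs
    have h1 := (hasDerivAt_omega (α := α) (show 0 < t - s by linarith [hs.2])).comp s
      ((hasDerivAt_id s).const_sub t)
    refine h1.congr_deriv ?_
    ring
  have hDi : IntervalIntegrable (fun s => (1 - α) * (t - s) ^ (α - 2) / Real.Gamma α)
      volume 0 ε := by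
    refine ContinuousOn.intervalIntegrable fun s hs => ContinuousAt.continuousWithinAt ?_
    rw [uIcc_of_le hε.le] at hs
    have : t - s ≠ 0 := by have := hs.2; linarith
    exact ((continuousAt_const.sub continuousAt_id).rpow_const (Or.inl this)).const_mul _
      |>.div_const _
  have hFTC := intervalIntegral.integral_eq_sub_of_hasDerivAt hD hDi
  have hle : |∫ s in (0:ℝ)..ε, F' t s| ≤
      ∫ s in (0:ℝ)..ε, η * ((1 - α) * (t - s) ^ (α - 2) / Real.Gamma α) := by
    refine intervalIntegral.abs_integral_le_integral_abs hε.le |>.trans ?_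
    refine intervalIntegral.integral_mono_on hε.le hd.1.abs (hDi.const_mul η) fun s hs => ?_
    have h0 : 0 < t - s := by linarith [hs.2]
    simp only [hF', abs_mul]
    rw [mul_comm]
    refine mul_le_mul (hgη s hs) ?_ (abs_nonneg _) hη
    rw [abs_div, abs_mul, abs_of_pos hΓ, abs_of_neg (by linarith : α - 1 < 0), neg_sub,
        abs_of_nonneg (Real.rpow_nonneg h0.le _)]
  refine hle.trans ?_
  rw [intervalIntegral.integral_const_mul, hFTC, sub_zero]
  have := omega_nonneg hα0 (show 0 < t by linarith)
  exact mul_le_mul_of_nonneg_left (by linarith) hη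

theorem integrable_weighted_indicator {H : Type*} [NormedAddCommGroup H] [NormedSpace ℝ H]
    {σ ε T : ℝ} (hσ : 0 ≤ σ) {f : ℝ → H} (hf : IntegrableOn f (Ioc ε T)) :
    Integrable (weighted σ ((Ioc ε T).indicator f)) := by
  have hi : Integrable ((Ioc ε T).indicator f) := hf.integrable_indicator measurableSet_Ioc
  refine hi.norm.mono' ?_ (Eventually.of_forall fun t => ?_)
  · exact (AEStronglyMeasurable.smul (Continuous.aestronglyMeasurable (by fun_prop))
      hi.aestronglyMeasurable).indicator measurableSet_Ioi
  · rcases le_or_gt t 0 with ht | ht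
    · rw [weighted_of_nonpos ht, norm_zero]; exact norm_nonneg _
    · rw [weighted_of_pos ht, norm_smul, Real.norm_of_nonneg (Real.exp_pos _).le]
      exact mul_le_of_le_one_left (norm_nonneg _) (Real.exp_le_one_iff.2 (by nlinarith))

theorem intervalIntegrable_integral_omega {H : Type*} [NormedAddCommGroup H] [NormedSpace ℝ H]
    (hα : 0 < α) {f : ℝ → H}
    (hf : Integrable (weighted 1 f)) {T : ℝ} (hT : 0 ≤ T) :
    IntervalIntegrable (fun t => ∫ s in (0 : ℝ)..t, omega α (t - s) • f s) volume 0 T := by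
  have h := (integrable_weighted_omega hα one_pos).integrable_convolution
    (ContinuousLinearMap.lsmul ℝ ℝ) hf
  rw [weighted_convolution] at h
  rw [intervalIntegrable_iff_integrableOn_Ioc_of_le hT]
  have h2 := IntegrableOn.continuousOn_smul_of_subset (Real.continuous_exp.continuousOn)
    (h.integrableOn (s := Ioc 0 T)) isCompact_Icc measurableSet_Ioc Ioc_subset_Icc_self
  refine h2.congr_fun (fun t ht => ?_) measurableSet_Ioc
  simp only [weighted_of_pos ht.1]
  rw [smul_smul, ← Real.exp_add]
  simp

/-- For `c` absolutely continuous on `[ε, T]`, the Riemann–Liouville derivative exists almost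
everywhere on `(ε, T)` and is `ω_α(t) c(ε) + ∫_ε^t ω_α(t-s) c'(s) ds`, up to a history term controlled
by the oscillation of `c` on `[0, ε]`. -/
theorem ae_hasDerivAt_fracInt {c : ℝ → ℝ} {T ε η : ℝ} (hα0 : 0 < α) (hα1 : α < 1)
    (hε : ε ∈ Ioo 0 T) (hc : ContinuousOn c (Icc 0 T))
    (hac : AbsolutelyContinuousOnInterval c ε T) (hη : ∀ s ∈ Icc 0 ε, |c s - c ε| ≤ η) :
    ∀ᵐ t, t ∈ Ioo ε T → ∃ q : ℝ, |q| ≤ η * omega α (t - ε) ∧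
      HasDerivAt (fracInt α c) (omega α t * c ε + q +
        ∫ s in (0 : ℝ)..t, omega α (t - s) • (Ioc ε T).indicator (deriv c) s) t := by
  have hT : 0 < T := hε.1.trans hε.2
  have hΓ := Real.Gamma_pos_of_pos hα0
  set f₁ := (Ioc ε T).indicator (deriv c) with hf₁
  have hdi : IntegrableOn (deriv c) (Ioc ε T) :=
    (intervalIntegrable_iff_integrableOn_Ioc_of_le hε.2.le).1 hac.intervalIntegrable_deriv
  have hf₁i : Integrable f₁ := hdi.integrable_indicator measurableSet_Ioc
  have hfw : Integrable (weighted 1 f₁) := integrable_weighted_indicator zero_le_one hdi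
  have hprim : ∀ s ∈ Icc 0 T, (∫ r in (0:ℝ)..s, f₁ r) = c (max s ε) - c ε := by
    intro s hs
    rcases le_or_gt s ε with hsε | hsε
    · rw [max_eq_right hsε, sub_self]
      refine intervalIntegral.integral_zero_ae (Eventually.of_forall fun r hr => ?_)
      rw [uIoc_of_le hs.1] at hr
      exact indicator_of_notMem (fun h => absurd h.1 (not_lt.2 (hr.2.trans hsε))) _
    · rw [max_eq_left hsε.le]
      have hmono := hac.mono (c := ε) (d := s) (by
        rw [uIcc_of_le hsε.le, uIcc_of_le hε.2.le]; exact Icc_subset_Icc_right hs.2)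
      rw [← hmono.integral_deriv_eq_sub, intervalIntegral.integral_of_le hs.1,
        intervalIntegral.integral_of_le hsε.le, hf₁, setIntegral_indicator measurableSet_Ioc]
      congr 2
      ext r
      simp only [mem_inter_iff, mem_Ioc]
      constructor
      · rintro ⟨h1, h2⟩; exact ⟨h2.1, h1.2⟩
      · rintro ⟨h1, h2⟩; exact ⟨⟨hε.1.trans h1, h2⟩, h1, h2.trans hs.2⟩
  set m : ℝ → ℝ := fun t => ∫ s in (0 : ℝ)..t, omega α (t - s) • f₁ s with hm
  have hmi : IntervalIntegrable m volume 0 T := intervalIntegrable_integral_omega hα0 hfw hT.le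
  set p : ℝ → ℝ := fun t => ∫ s in (0 : ℝ)..ε, omega α (t - s) • (c s - c ε) with hp
  have hform : ∀ t ∈ Ioo ε T, fracInt α c t =
      p t + t ^ α / (α * Real.Gamma α) * c ε + ∫ r in (0:ℝ)..t, m r := by
    intro t ht
    have ht0 : 0 < t := hε.1.trans ht.1
    rw [← integral_omega_smul_integral hα0 hfw ht0, ← integral_omega_sub hα0 t,
      ← intervalIntegral.integral_mul_const, fracInt]
    have hci : ContinuousOn c (uIcc 0 t) := by
      rw [uIcc_of_le ht0.le]; exact hc.mono (Icc_subset_Icc_right ht.2.le)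
    have hΩ := intervalIntegrable_omega_sub hα0 t
    have hprimc : ContinuousOn (fun s => ∫ r in (0:ℝ)..s, f₁ r) (uIcc 0 t) :=
      (intervalIntegral.continuous_primitive (fun a b => hf₁i.intervalIntegrable) 0).continuousOn
    have hp0 : p t = ∫ s in (0:ℝ)..t, omega α (t - s) •
        (c s - c ε - ∫ r in (0:ℝ)..s, f₁ r) := by
      rw [hp, ← intervalIntegral.integral_add_adjacent_intervals (b := ε) (c := t)]
      · rw [intervalIntegral.integral_zero_ae (a := ε), add_zero]
        · refine intervalIntegral.integral_congr fun s hs => ?_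
          rw [uIcc_of_le hε.1.le] at hs
          rw [hprim s ⟨hs.1, hs.2.trans hε.2.le⟩, max_eq_right hs.2, sub_self, sub_zero]
        · refine Eventually.of_forall fun s hs => ?_
          rw [uIoc_of_le ht.1.le] at hs
          rw [hprim s ⟨hε.1.le.trans hs.1.le, hs.2.trans ht.2.le⟩, max_eq_left hs.1.le, sub_self,
            smul_zero]
      · refine (hΩ 0 ε).mul_continuousOn (((hci.sub continuousOn_const).sub hprimc).mono ?_)
        rw [uIcc_of_le ht0.le, uIcc_of_le hε.1.le]; exact Icc_subset_Icc_right ht.1.le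
      · refine (hΩ ε t).mul_continuousOn (((hci.sub continuousOn_const).sub hprimc).mono ?_)
        rw [uIcc_of_le ht0.le, uIcc_of_le ht.1.le]; exact Icc_subset_Icc_left hε.1.le
    rw [hp0, ← intervalIntegral.integral_add, ← intervalIntegral.integral_add]
    · refine intervalIntegral.integral_congr fun s _ => ?_
      simp only [smul_eq_mul]
      ring
    · exact ((hΩ 0 t).mul_continuousOn ((hci.sub continuousOn_const).sub hprimc)).add
        ((hΩ 0 t).mul_const _)
    · exact (hΩ 0 t).mul_continuousOn hprimc
    · exact (hΩ 0 t).mul_continuousOn ((hci.sub continuousOn_const).sub hprimc)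
    · exact (hΩ 0 t).mul_const _
  filter_upwards [hmi.ae_hasDerivAt_integral] with t hmt ht
  have ht0 : 0 < t := hε.1.trans ht.1
  obtain ⟨q, hq, hpq⟩ := hasDerivAt_history hα0 hα1 hε.1 (g := fun s => c s - c ε)
    ((hc.mono (Icc_subset_Icc_right hε.2.le)).sub continuousOn_const) hη ht.1
  refine ⟨q, hq, ?_⟩
  have h2 := ((Real.hasDerivAt_rpow_const (p := α) (Or.inl ht0.ne')).div_const
    (α * Real.Gamma α)).mul_const (c ε)
  have h3 := hmt (by rw [uIcc_of_le hT.le]; exact ⟨ht0.le, ht.2.le⟩) 0 left_mem_uIcc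
  have h4 := (hpq.add h2).add h3
  have h5 : fracInt α c =ᶠ[𝓝 t]
      (fun t => p t + t ^ α / (α * Real.Gamma α) * c ε + ∫ r in (0:ℝ)..t, m r) := by
    filter_upwards [isOpen_Ioo.mem_nhds ht] with r hr using hform r hr
  refine (h4.congr_of_eventuallyEq h5).congr_deriv ?_
  rw [omega]
  field_simp
  ring

end FractionalDerivative

/-! ### Integrability up to `t = 0`, and stability in a Hilbert space -/

section Evolution

theorem exists_pos_mul_rpow_neg_le {α : ℝ} (hα : 0 < α) (c : ℝ) :
    ∃ σ : ℝ, 0 < σ ∧ c * σ ^ (-α) ≤ 1 / 2 := by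
  have h := (tendsto_rpow_neg_atTop hα).const_mul c
  rw [mul_zero] at h
  obtain ⟨σ, h1, h2⟩ := ((h.eventually (eventually_le_nhds (by norm_num : (0:ℝ) < 1 / 2))).and
    (eventually_gt_atTop 0)).exists
  exact ⟨σ, h2, h1⟩

theorem tendsto_setIntegral_Ioc_zero {g : ℝ → ℝ} (hg : Integrable g) :
    Tendsto (fun ε => ∫ t in Ioc 0 ε, g t) (𝓝[>] 0) (𝓝 0) := by
  have h := (intervalIntegral.continuous_primitive
    (fun a b => hg.intervalIntegrable (a := a) (b := b)) 0).tendsto 0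
  rw [intervalIntegral.integral_same] at h
  refine (h.mono_left nhdsWithin_le_nhds).congr' ?_
  filter_upwards [self_mem_nhdsWithin] with ε hε
  rw [intervalIntegral.integral_of_le (le_of_lt hε)]

variable {H : Type*} [NormedAddCommGroup H]

section Normed

variable [NormedSpace ℝ H] {α T σ C : ℝ} {f W U : ℝ → H} {η : ℝ → ℝ}

/-- The history estimate after multiplication by the exponential weight. -/
theorem weighted_history_estimate (hα : 0 < α) (hσ : 0 < σ) {ε : ℝ} (hε : 0 ≤ ε) (hη : 0 ≤ η ε)
    (hW : ∀ᵐ t, t ∈ Ioo ε T → ‖W t - (omega α t • U ε +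
      ∫ s in (0 : ℝ)..t, omega α (t - s) • (Ioc ε T).indicator f s)‖ ≤ η ε * omega α (t - ε)) :
    ∀ᵐ t, t ∈ Ioo ε T → ‖Real.exp (-σ * t) • W t - (weighted σ (omega α) t • U ε +
      (weighted σ (omega α) ⋆ weighted σ ((Ioc ε T).indicator f)) t)‖ ≤
        η ε * weighted σ (omega α) (t - ε) := by
  filter_upwards [hW] with t hWt ht
  have ht0 : 0 < t := hε.trans_lt ht.1
  have htε : 0 < t - ε := sub_pos.2 ht.1
  rw [weighted_convolution, weighted_of_pos ht0, weighted_of_pos ht0, weighted_of_pos htε,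
    smul_assoc, ← smul_add, ← smul_sub, norm_smul, Real.norm_of_nonneg (Real.exp_pos _).le]
  have h1 := mul_le_mul_of_nonneg_left (hWt ht) (Real.exp_pos (-σ * t)).le
  have h2 : Real.exp (-σ * t) ≤ Real.exp (-σ * (t - ε)) := Real.exp_le_exp.2 (by nlinarith)
  have h3 := mul_le_mul_of_nonneg_right h2 (mul_nonneg hη (omega_nonneg hα htε))
  rw [smul_eq_mul]
  linarith

theorem weighted_indicator {ε : ℝ} (hε : 0 ≤ ε) (f : ℝ → H) :
    weighted σ ((Ioc ε T).indicator f) = (Ioc ε T).indicator fun t => Real.exp (-σ * t) • f t := by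
  ext t
  by_cases ht : t ∈ Ioc ε T
  · rw [indicator_of_mem ht, weighted_of_pos (hε.trans_lt ht.1), indicator_of_mem ht]
  · rw [indicator_of_notMem ht]
    rcases le_or_gt t 0 with h | h
    · exact weighted_of_nonpos h _
    · rw [weighted_of_pos h, indicator_of_notMem ht, smul_zero]

/-- A bound for `W` in a weighted `L¹(ε, T)` that does not degenerate as `ε → 0`. -/
theorem integral_weighted_norm_le (hα : 0 < α) (hσ : 0 < σ)
    (hCσ : C * σ ^ (-α) ≤ 1 / 2) (hWm : AEStronglyMeasurable W) {ε : ℝ} (hε : 0 ≤ ε)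
    (hη : 0 ≤ η ε) (hf : IntegrableOn f (Ioc ε T))
    (hW : ∀ᵐ t, t ∈ Ioo ε T → ‖W t - (omega α t • U ε +
      ∫ s in (0 : ℝ)..t, omega α (t - s) • (Ioc ε T).indicator f s)‖ ≤ η ε * omega α (t - ε))
    (hfW : ∀ᵐ t, t ∈ Ioo 0 T → ‖f t‖ ≤ C * ‖W t‖) :
    IntegrableOn (fun t => Real.exp (-σ * t) * ‖W t‖) (Ioc ε T) ∧
      ∫ t in Ioc ε T, Real.exp (-σ * t) * ‖W t‖ ≤ 2 * (σ ^ (-α) * (‖U ε‖ + η ε)) := by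
  set om := weighted σ (omega α) with hom
  set F := weighted σ ((Ioc ε T).indicator f) with hF
  have homi : Integrable om := integrable_weighted_omega hα hσ
  have hom0 : ∀ t, 0 ≤ om t := weighted_omega_nonneg hα
  have hFi : Integrable F := integrable_weighted_indicator hσ.le hf
  set g : ℝ → ℝ := fun t => om t * ‖U ε‖ + η ε * om (t - ε) with hg
  have hgi : Integrable g := (homi.mul_const _).add ((homi.comp_sub_right ε).const_mul _)
  have hg0 : ∀ t, 0 ≤ g t := fun t =>
    add_nonneg (mul_nonneg (hom0 _) (norm_nonneg _)) (mul_nonneg hη (hom0 _))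
  set y : ℝ → ℝ := (Ioc ε T).indicator fun t => Real.exp (-σ * t) * ‖W t‖ with hy
  have hy0 : ∀ t, 0 ≤ y t := indicator_nonneg fun t _ =>
    mul_nonneg (Real.exp_pos _).le (norm_nonneg _)
  have hTne : ∀ᵐ t : ℝ, t ≠ T := by simp [ae_iff, measure_singleton]
  have h1 : ∀ᵐ t, y t ≤ g t + (om ⋆ fun s => ‖F s‖) t := by
    filter_upwards [weighted_history_estimate hα hσ hε hη hW, hTne] with t ht htT
    by_cases h : t ∈ Ioc ε T
    · have h2 := ht ⟨h.1, lt_of_le_of_ne h.2 htT⟩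
      rw [hy, indicator_of_mem h]
      have h3 : Real.exp (-σ * t) * ‖W t‖ = ‖Real.exp (-σ * t) • W t‖ := by
        rw [norm_smul, Real.norm_of_nonneg (Real.exp_pos _).le]
      have h4 := norm_le_norm_add_norm_sub' (Real.exp (-σ * t) • W t) (om t • U ε + (om ⋆ F) t)
      have h5 := norm_add_le (om t • U ε) ((om ⋆ F) t)
      have h6 := norm_convolution_le hom0 F t
      rw [norm_smul, Real.norm_of_nonneg (hom0 t)] at h5
      simp only [h3, hg]
      linarith
    · rw [hy, indicator_of_notMem h]
      exact add_nonneg (hg0 t) (convolution_nonneg hom0 (fun _ => norm_nonneg _) t)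
  have hym : AEStronglyMeasurable y :=
    ((Continuous.aestronglyMeasurable (by fun_prop)).mul hWm.norm).indicator measurableSet_Ioc
  have hyi : Integrable y := by
    refine (hgi.add (homi.integrable_convolution (ContinuousLinearMap.lsmul ℝ ℝ) hFi.norm)).mono'
      hym ?_
    filter_upwards [h1] with t ht
    rw [Real.norm_of_nonneg (hy0 t)]
    exact ht
  have hFy : (fun s => ‖F s‖) ≤ᵐ[volume] C • y := by
    filter_upwards [hfW, hTne] with t ht htT
    rw [hF, weighted_indicator hε, Pi.smul_apply, hy]
    by_cases h : t ∈ Ioc ε T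
    · rw [indicator_of_mem h, indicator_of_mem h, norm_smul,
        Real.norm_of_nonneg (Real.exp_pos _).le, smul_eq_mul]
      have := mul_le_mul_of_nonneg_left (ht ⟨hε.trans_lt h.1, lt_of_le_of_ne h.2 htT⟩)
        (Real.exp_pos (-σ * t)).le
      linarith
    · simp [indicator_of_notMem h]
  have h2 := convolution_mono_ae homi hom0 hFi.norm (hyi.smul C) hFy
  rw [convolution_smul] at h2
  have h3 : ∀ᵐ t, y t ≤ g t + C * (om ⋆ y) t := by
    filter_upwards [h1, h2] with t h1 h2
    simp only [Pi.smul_apply, smul_eq_mul] at h2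
    linarith
  have h4 := integral_le_of_le_add_convolution homi hgi hyi hy0
    (by rwa [integral_weighted_omega hα hσ]) h3
  rw [hy, integral_indicator measurableSet_Ioc] at h4
  refine ⟨(integrable_indicator_iff measurableSet_Ioc).1 hyi, h4.trans_eq ?_⟩
  rw [hg, integral_add (homi.mul_const _) ((homi.comp_sub_right ε).const_mul _),
    integral_mul_const, integral_const_mul, integral_sub_right_eq_self om ε,
    integral_weighted_omega hα hσ]
  ring

/-- If the fractional derivative `W` of `U` dominates `U' = f`, then `f` is integrable up to
`t = 0`, and `W = ω_α U(0) + I^α f`. -/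
theorem integrableOn_and_eq_omega_add [CompleteSpace H] (hα : 0 < α) (hT : 0 < T) (hC : 0 ≤ C)
    (hWm : AEStronglyMeasurable W) (hfm : AEStronglyMeasurable f)
    (hη0 : ∀ ε, 0 ≤ η ε) (hη : Tendsto η (𝓝[>] 0) (𝓝 0))
    (hU : Tendsto U (𝓝[>] 0) (𝓝 (U 0)))
    (hf : ∀ ε ∈ Ioo 0 T, IntegrableOn f (Ioc ε T))
    (hW : ∀ ε ∈ Ioo 0 T, ∀ᵐ t, t ∈ Ioo ε T → ‖W t - (omega α t • U ε +
      ∫ s in (0 : ℝ)..t, omega α (t - s) • (Ioc ε T).indicator f s)‖ ≤ η ε * omega α (t - ε))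
    (hfW : ∀ᵐ t, t ∈ Ioo 0 T → ‖f t‖ ≤ C * ‖W t‖) :
    IntegrableOn f (Ioc 0 T) ∧ ∀ᵐ t, t ∈ Ioo 0 T →
      W t = omega α t • U 0 + ∫ s in (0 : ℝ)..t, omega α (t - s) • (Ioc 0 T).indicator f s := by
  obtain ⟨σ, hσ, hCσ⟩ := exists_pos_mul_rpow_neg_le hα C
  have hσα : 0 < σ ^ (-α) := Real.rpow_pos_of_pos hσ _
  have hTne : ∀ᵐ t : ℝ, t ≠ T := by simp [ae_iff, measure_singleton]
  have hIoo : ∀ᶠ ε in 𝓝[>] (0:ℝ), ε ∈ Ioo 0 T := Ioo_mem_nhdsGT hT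
  -- integrability of the weighted `W`
  have hWi : IntegrableOn (fun t => Real.exp (-σ * t) * ‖W t‖) (Ioc 0 T) := by
    have hb : Tendsto (fun ε => 2 * (σ ^ (-α) * (‖U ε‖ + η ε))) (𝓝[>] 0)
        (𝓝 (2 * (σ ^ (-α) * (‖U 0‖ + 0)))) := ((hU.norm.add hη).const_mul _).const_mul _
    set a : ℕ → ℝ := fun n => T / (n + 2) with ha
    have ha0 : ∀ n, a n ∈ Ioo 0 T := fun n => by
      have hn : (0:ℝ) ≤ n := n.cast_nonneg
      refine ⟨by positivity, ?_⟩
      rw [ha, div_lt_iff₀ (by positivity)]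
      nlinarith
    have hat : Tendsto a atTop (𝓝 0) :=
      tendsto_const_nhds.div_atTop
        (tendsto_atTop_add_const_right _ _ tendsto_natCast_atTop_atTop)
    have hat' : Tendsto a atTop (𝓝[>] 0) :=
      tendsto_nhdsWithin_iff.2 ⟨hat, Eventually.of_forall fun n => (ha0 n).1⟩
    have hest := fun n => integral_weighted_norm_le (η := η) (U := U) hα hσ hCσ hWm (ha0 n).1.le
      (hη0 _) (hf _ (ha0 n)) (hW _ (ha0 n)) hfW
    refine integrableOn_Ioc_of_intervalIntegral_norm_bounded_left
      (I := 2 * (σ ^ (-α) * (‖U 0‖ + 0)) + 1) (fun n => (hest n).1) hat ?_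
    filter_upwards [(hb.comp hat').eventually (eventually_le_nhds (lt_add_one _))] with n hn
    refine le_trans (le_of_eq ?_) ((hest n).2.trans hn)
    refine integral_congr_ae (Eventually.of_forall fun t => ?_)
    simp
  have hfi : IntegrableOn f (Ioc 0 T) := by
    refine (hWi.const_mul (C * Real.exp (σ * T))).mono' hfm.restrict
      ((ae_restrict_iff' measurableSet_Ioc).2 ?_)
    filter_upwards [hfW, hTne] with t ht htT h
    refine (ht ⟨h.1, lt_of_le_of_ne h.2 htT⟩).trans ?_
    have h1 : 1 ≤ Real.exp (σ * T) * Real.exp (-σ * t) := by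
      rw [← Real.exp_add]
      exact Real.one_le_exp (by nlinarith [h.2])
    have h2 := mul_le_mul_of_nonneg_right h1 (mul_nonneg hC (norm_nonneg (W t)))
    linarith
  refine ⟨hfi, ?_⟩
  set om := weighted σ (omega α) with hom
  have homi : Integrable om := integrable_weighted_omega hα hσ
  have hom0 : ∀ t, 0 ≤ om t := weighted_omega_nonneg hα
  set F : ℝ → ℝ → H := fun ε => weighted σ ((Ioc ε T).indicator f) with hF
  have hFi : ∀ ε, 0 ≤ ε → Integrable (F ε) := fun ε hε =>
    integrable_weighted_indicator hσ.le (hfi.mono_set (Ioc_subset_Ioc_left hε))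
  -- the (weighted) defect in the asserted identity
  set g : ℝ → ℝ := (Ioc 0 T).indicator fun t =>
    ‖Real.exp (-σ * t) • W t - (om t • U 0 + (om ⋆ F 0) t)‖ with hg
  have hgi : Integrable g := by
    rw [hg, integrable_indicator_iff measurableSet_Ioc]
    refine Integrable.norm (Integrable.sub ?_ ?_)
    · refine hWi.mono' ?_ (Eventually.of_forall fun t => ?_)
      · exact ((Continuous.aestronglyMeasurable (by fun_prop)).smul hWm).restrict
      · rw [norm_smul, Real.norm_of_nonneg (Real.exp_pos _).le]
    · exact ((homi.smul_const _).add (homi.integrable_convolution _ (hFi 0 le_rfl))).integrableOn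
  have hg0 : ∀ t, 0 ≤ g t := indicator_nonneg fun t _ => norm_nonneg _
  set E : ℝ → ℝ → ℝ := fun ε t => η ε * om (t - ε) + om t * ‖U ε - U 0‖ +
    (om ⋆ fun s => ‖(F ε - F 0) s‖) t + (Ioc 0 ε).indicator g t with hE
  have hdiff : ∀ ε ∈ Ioo 0 T, ∀ t, ‖(F ε - F 0) t‖ = (Ioc 0 ε).indicator (fun t => ‖F 0 t‖) t := by
    intro ε hε t
    simp only [hF, Pi.sub_apply]
    rw [weighted_indicator hε.1.le, weighted_indicator le_rfl]
    simp only [indicator_apply, mem_Ioc]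
    have := hε.1
    have := hε.2
    by_cases h1 : 0 < t <;> by_cases h2 : t ≤ ε <;> by_cases h3 : t ≤ T <;>
      first
        | (exfalso; linarith)
        | (have h4 : ¬ ε < t := not_lt.2 h2
           simp [h1, h2, h3, h4])
        | (have h4 : ε < t := not_le.1 h2
           simp [h1, h2, h3, h4])
  have hlim : Tendsto (fun ε => ∫⁻ t, ‖E ε t‖ₑ) (𝓝[>] 0) (𝓝 0) := by
    have l1 : Tendsto (fun ε => ‖U ε - U 0‖) (𝓝[>] 0) (𝓝 0) := by
      simpa using (hU.sub_const (U 0)).norm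
    have l2 := tendsto_setIntegral_Ioc_zero hgi
    have l3 := tendsto_setIntegral_Ioc_zero (hFi 0 le_rfl).norm
    have l4 := (((hη.mul_const (σ ^ (-α))).add (l1.const_mul (σ ^ (-α)))).add
      (l3.const_mul (σ ^ (-α)))).add l2
    simp only [mul_zero, zero_mul, add_zero] at l4
    have l5 := (ENNReal.tendsto_ofReal l4)
    rw [ENNReal.ofReal_zero] at l5
    refine l5.congr' ?_
    filter_upwards [hIoo] with ε hε
    have i1 : Integrable fun t => η ε * om (t - ε) := (homi.comp_sub_right ε).const_mul _
    have i2 : Integrable fun t => om t * ‖U ε - U 0‖ := homi.mul_const _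
    have i3' : Integrable fun s => ‖(F ε - F 0) s‖ := ((hFi ε hε.1.le).sub (hFi 0 le_rfl)).norm
    have i3 := homi.integrable_convolution (ContinuousLinearMap.lsmul ℝ ℝ) i3'
    have i4 : Integrable ((Ioc 0 ε).indicator g) := hgi.indicator measurableSet_Ioc
    have i12 : Integrable fun t => η ε * om (t - ε) + om t * ‖U ε - U 0‖ := i1.add i2
    have i123 : Integrable fun t => η ε * om (t - ε) + om t * ‖U ε - U 0‖ +
      (om ⋆ fun s => ‖(F ε - F 0) s‖) t := i12.add i3
    have hE0 : ∀ t, 0 ≤ E ε t := fun t => by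
      have := mul_nonneg (hη0 ε) (hom0 (t - ε))
      have := mul_nonneg (hom0 t) (norm_nonneg (U ε - U 0))
      have := convolution_nonneg hom0 (fun s => norm_nonneg ((F ε - F 0) s)) t
      have : 0 ≤ (Ioc 0 ε).indicator g t := indicator_nonneg (fun t _ => hg0 t) t
      simp only [hE]
      linarith
    have e4 : ∫ t, (Ioc 0 ε).indicator g t = ∫ t in Ioc 0 ε, g t :=
      integral_indicator measurableSet_Ioc
    have e5 : ∫ t, (Ioc 0 ε).indicator (fun t => ‖F 0 t‖) t = ∫ t in Ioc 0 ε, ‖F 0 t‖ :=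
      integral_indicator measurableSet_Ioc
    have iE : Integrable (E ε) := i123.add i4
    rw [← ofReal_integral_norm_eq_lintegral_enorm iE]
    congr 1
    simp only [Real.norm_of_nonneg (hE0 _)]
    simp only [hE]
    rw [integral_add i123 i4, integral_add i12 i3, integral_add i1 i2,
      integral_const_mul, integral_sub_right_eq_self om ε, integral_mul_const,
      integral_convolution_real homi i3', e4, integral_weighted_omega hα hσ]
    simp_rw [hdiff ε hε]
    rw [e5]
  have hmain : ∀ᵐ t, g t ≤ 0 := by
    refine ae_nonpos_of_tendsto_lintegral hgi.aemeasurable ?_ hlim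
    filter_upwards [hIoo] with ε hε
    filter_upwards [weighted_history_estimate hα hσ hε.1.le (hη0 ε) (hW ε hε), hTne,
      convolution_sub_ae homi (hFi ε hε.1.le) (hFi 0 le_rfl)] with t ht htT hconv
    have e1 := mul_nonneg (hη0 ε) (hom0 (t - ε))
    have e2 := mul_nonneg (hom0 t) (norm_nonneg (U ε - U 0))
    have e3 := convolution_nonneg hom0 (fun s => norm_nonneg ((F ε - F 0) s)) t
    have e4 : 0 ≤ (Ioc 0 ε).indicator g t := indicator_nonneg (fun t _ => hg0 t) t
    simp only [hE]
    by_cases h : t ∈ Ioc 0 ε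
    · rw [indicator_of_mem h]
      linarith
    by_cases h' : t ∈ Ioc 0 T
    · have htε : ε < t := by
        by_contra hh
        exact h ⟨h'.1, not_lt.1 hh⟩
      have h2 := ht ⟨htε, lt_of_le_of_ne h'.2 htT⟩
      have h3 := norm_convolution_le hom0 (F ε - F 0) t
      rw [hg, indicator_of_mem h']
      rw [hconv, Pi.sub_apply] at h3
      have h5 : Real.exp (-σ * t) • W t - (om t • U 0 + (om ⋆ F 0) t) =
          (Real.exp (-σ * t) • W t - (om t • U ε + (om ⋆ F ε) t)) +
          (om t • (U ε - U 0)) + ((om ⋆ F ε) t - (om ⋆ F 0) t) := by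
        rw [smul_sub]; abel
      have h6 := norm_add₃_le (a := Real.exp (-σ * t) • W t - (om t • U ε + (om ⋆ F ε) t))
        (b := om t • (U ε - U 0)) (c := (om ⋆ F ε) t - (om ⋆ F 0) t)
      rw [← h5, norm_smul, Real.norm_of_nonneg (hom0 t)] at h6
      rw [hg] at e4
      linarith
    · rw [hg, indicator_of_notMem h']
      rw [hg] at e4
      linarith
  filter_upwards [hmain] with t ht h
  rw [hg, indicator_of_mem (Ioo_subset_Ioc_self h)] at ht
  have h1 := sub_eq_zero.1 (norm_eq_zero.1 (le_antisymm ht (norm_nonneg _)))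
  rw [weighted_convolution, weighted_of_pos h.1, hom, weighted_of_pos h.1, smul_assoc,
    ← smul_add] at h1
  exact smul_right_injective H (Real.exp_pos (-σ * t)).ne' h1

end Normed

/-- Stability for an abstract fractional evolution equation: `U' = f`, the fractional derivative
`W` of `U` dominates `f`, and `⟨f, W⟩ ≤ c ‖W‖²`.  The bound depends on `c`, but not on the
constant `C` with `‖f‖ ≤ C ‖W‖`. -/
theorem norm_le_of_fractional_evolution [InnerProductSpace ℝ H] [CompleteSpace H]
    {α T σ c C : ℝ} {f W U : ℝ → H} {η : ℝ → ℝ}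
    (hα0 : 0 < α) (hα1 : α < 1) (hT : 0 < T) (hσ : 0 < σ) (hc : 0 ≤ c)
    (hcσ : c * σ ^ (-α) ≤ 1 / 2) (hC : 0 ≤ C)
    (hWm : AEStronglyMeasurable W) (hfm : AEStronglyMeasurable f)
    (hη0 : ∀ ε, 0 ≤ η ε) (hη : Tendsto η (𝓝[>] 0) (𝓝 0))
    (hU : Tendsto U (𝓝[>] 0) (𝓝 (U 0)))
    (hf : ∀ ε ∈ Ioo 0 T, IntegrableOn f (Ioc ε T))
    (hUf : ∀ ε ∈ Ioo 0 T, ∀ t ∈ Icc ε T, U t = U ε + ∫ s in ε..t, f s)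
    (hW : ∀ ε ∈ Ioo 0 T, ∀ᵐ t, t ∈ Ioo ε T → ‖W t - (omega α t • U ε +
      ∫ s in (0 : ℝ)..t, omega α (t - s) • (Ioc ε T).indicator f s)‖ ≤ η ε * omega α (t - ε))
    (hfW : ∀ᵐ t, t ∈ Ioo 0 T → ‖f t‖ ≤ C * ‖W t‖)
    (hcW : ∀ᵐ t, t ∈ Ioo 0 T → inner ℝ (f t) (W t) ≤ c * ‖W t‖ ^ 2) :
    ∀ t ∈ Icc 0 T, ‖U t‖ ≤ 2 * Real.exp (σ * T) * ‖U 0‖ := by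
  obtain ⟨hfi, hWeq⟩ := integrableOn_and_eq_omega_add hα0 hT hC hWm hfm hη0 hη hU hf hW hfW
  set φ := (Ioc 0 T).indicator f with hφ
  have hφi : Integrable φ := hfi.integrable_indicator measurableSet_Ioc
  have hφw : Integrable (weighted σ φ) := integrable_weighted_indicator hσ.le hfi
  have hTne : ∀ᵐ t : ℝ, t ≠ T := by simp [ae_iff, measure_singleton]
  have hae := exp_mul_norm_le_two_mul (u₀ := U 0) (φ := φ) hα0 hα1 hσ hc hcσ hφw (ae_eq_refl _) (by
    filter_upwards [hWeq, hcW, hTne] with t h1 h2 htT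
    by_cases ht : t ∈ Ioc 0 T
    · have ht' : t ∈ Ioo 0 T := ⟨ht.1, lt_of_le_of_ne ht.2 htT⟩
      have h3 : weighted σ (omega α) t • U 0 + (weighted σ (omega α) ⋆ weighted σ φ) t =
          Real.exp (-σ * t) • W t := by
        rw [weighted_convolution, weighted_of_pos ht.1, weighted_of_pos ht.1, smul_assoc,
          ← smul_add, h1 ht']
      rw [h3, weighted_of_pos ht.1, hφ, indicator_of_mem ht, real_inner_smul_left,
        real_inner_smul_right, norm_smul, Real.norm_of_nonneg (Real.exp_pos _).le]
      have h4 := mul_le_mul_of_nonneg_left (h2 ht')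
        (mul_pos (Real.exp_pos (-σ * t)) (Real.exp_pos (-σ * t))).le
      nlinarith
    · rw [hφ, weighted_indicator le_rfl, indicator_of_notMem ht, inner_zero_left]
      positivity)
  -- the primitive is continuous, so the bound holds at every positive time
  have hprim : Continuous fun t => ∫ s in (0:ℝ)..t, φ s :=
    intervalIntegral.continuous_primitive (fun a b => hφi.intervalIntegrable) 0
  have hall : ∀ t, 0 < t → Real.exp (-σ * t) * ‖U 0 + ∫ s in (0 : ℝ)..t, φ s‖ ≤ 2 * ‖U 0‖ := by
    have hopen : IsOpen {t : ℝ | 0 < t ∧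
        2 * ‖U 0‖ < Real.exp (-σ * t) * ‖U 0 + ∫ s in (0 : ℝ)..t, φ s‖} :=
      (isOpen_lt continuous_const continuous_id).inter
        (isOpen_lt continuous_const
          ((by fun_prop : Continuous fun t : ℝ => Real.exp (-σ * t)).mul
            (continuous_const.add hprim).norm))
    have hnull : volume {t : ℝ | 0 < t ∧
        2 * ‖U 0‖ < Real.exp (-σ * t) * ‖U 0 + ∫ s in (0 : ℝ)..t, φ s‖} = 0 := by
      rw [ae_iff] at hae
      convert hae using 2
      ext t
      simp only [mem_ofPred_eq, Classical.not_imp, not_le]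
    have hempty := (hopen.measure_eq_zero_iff volume).1 hnull
    intro t ht
    by_contra hcon
    have : t ∈ (∅ : Set ℝ) := hempty ▸ ⟨ht, not_le.1 hcon⟩
    exact this
  have hUeq : ∀ t ∈ Ioc 0 T, U t = U 0 + ∫ s in (0:ℝ)..t, φ s := by
    intro t ht
    have l1 : Tendsto (fun ε => U ε + ∫ s in ε..t, φ s) (𝓝[>] 0)
        (𝓝 (U 0 + ∫ s in (0:ℝ)..t, φ s)) := by
      refine hU.add ?_
      have h : Continuous fun ε => ∫ s in ε..t, φ s := by
        have h2 : (fun ε => ∫ s in ε..t, φ s) =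
            fun ε => (∫ s in (0:ℝ)..t, φ s) - ∫ s in (0:ℝ)..ε, φ s := by
          ext ε
          rw [intervalIntegral.integral_interval_sub_left hφi.intervalIntegrable
            hφi.intervalIntegrable]
        rw [h2]
        exact continuous_const.sub hprim
      exact (h.tendsto 0).mono_left nhdsWithin_le_nhds
    refine tendsto_nhds_unique (tendsto_const_nhds.congr' ?_) l1
    filter_upwards [Ioo_mem_nhdsGT ht.1] with ε hε
    rw [hUf ε ⟨hε.1, hε.2.trans_le ht.2⟩ t ⟨hε.2.le, ht.2⟩]
    congr 1
    refine intervalIntegral.integral_congr_ae (Eventually.of_forall fun s hs => ?_)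
    rw [uIoc_of_le hε.2.le] at hs
    rw [hφ, indicator_of_mem (mem_Ioc.2 ⟨hε.1.trans hs.1, hs.2.trans ht.2⟩)]
  intro t ht
  have hexpT : 1 ≤ Real.exp (σ * T) := Real.one_le_exp (by positivity)
  rcases ht.1.eq_or_lt with h0 | h0
  · rw [← h0]
    have := norm_nonneg (U 0)
    nlinarith
  · have h1 := hall t h0
    rw [← hUeq t ⟨h0, ht.2⟩] at h1
    have h2 := mul_le_mul_of_nonneg_left h1 (Real.exp_pos (σ * T)).le
    have h3 : 1 ≤ Real.exp (σ * T) * Real.exp (-σ * t) := by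
      rw [← Real.exp_add]
      exact Real.one_le_exp (by nlinarith [ht.2])
    have h4 := mul_le_mul_of_nonneg_right h3 (norm_nonneg (U t))
    linarith

end Evolution

/-! ### Evolutions in the span of finitely many vectors -/

section FiniteSpan

variable {α T : ℝ}

/-- A function that is continuous on `[0, T]` has small oscillation on `[0, ε]` for small `ε`. -/
theorem exists_oscillation_bound {c : ℝ → ℝ} (hT : 0 < T) (hc : ContinuousOn c (Icc 0 T)) :
    ∃ η : ℝ → ℝ, (∀ ε, 0 ≤ η ε) ∧ Tendsto η (𝓝[>] 0) (𝓝 0) ∧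
      ∀ ε ∈ Ioo 0 T, ∀ s ∈ Icc 0 ε, |c s - c ε| ≤ η ε := by
  refine ⟨fun ε => sSup ((fun s => |c s - c ε|) '' Icc 0 ε), fun ε => ?_, ?_, ?_⟩
  · exact Real.sSup_nonneg (by rintro _ ⟨s, _, rfl⟩; exact abs_nonneg _)
  · rw [Metric.tendsto_nhds]
    intro e he
    have h0 := Metric.continuousWithinAt_iff.1 (hc 0 ⟨le_rfl, hT.le⟩) (e / 4) (by linarith)
    obtain ⟨δ, hδ, h0⟩ := h0
    filter_upwards [Ioo_mem_nhdsGT (lt_min hδ hT)] with ε hε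
    have hεδ := hε.2.trans_le (min_le_left _ _)
    have hεT := hε.2.trans_le (min_le_right _ _)
    have hb : ∀ s ∈ Icc 0 ε, |c s - c 0| ≤ e / 4 := by
      intro s hs
      have := h0 (x := s) ⟨hs.1, hs.2.trans hεT.le⟩
        (by rw [Real.dist_eq, sub_zero, abs_of_nonneg hs.1]; exact hs.2.trans_lt hεδ)
      exact this.le
    have hle : sSup ((fun s => |c s - c ε|) '' Icc 0 ε) ≤ e / 2 := by
      refine csSup_le ⟨_, 0, ⟨le_rfl, hε.1.le⟩, rfl⟩ ?_
      rintro _ ⟨s, hs, rfl⟩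
      have h1 := abs_sub_le (c s) (c 0) (c ε)
      have h2 := hb s hs
      have h3 := hb ε ⟨hε.1.le, le_rfl⟩
      rw [abs_sub_comm (c ε)] at h3
      simp only
      linarith
    have hnn : 0 ≤ sSup ((fun s => |c s - c ε|) '' Icc 0 ε) :=
      Real.sSup_nonneg (by rintro _ ⟨s, _, rfl⟩; exact abs_nonneg _)
    rw [Real.dist_eq, sub_zero, abs_of_nonneg hnn]
    linarith
  · intro ε hε s hs
    refine le_csSup ?_ ⟨s, hs, rfl⟩
    exact isCompact_Icc.bddAbove_image
      (((hc.mono (Icc_subset_Icc_right hε.2.le)).sub continuousOn_const).abs)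

theorem ae_intervalIntegrable_omega_smul (hα : 0 < α) {f : ℝ → ℝ}
    (hf : Integrable (weighted 1 f)) :
    ∀ᵐ t, 0 < t → IntervalIntegrable (fun s => omega α (t - s) • f s) volume 0 t := by
  filter_upwards [(integrable_weighted_omega hα one_pos).ae_convolution_exists
    (ContinuousLinearMap.lsmul ℝ ℝ) hf] with t ht ht0
  have h := (ht.integrable_swap.integrableOn (s := Ioo 0 t)).const_mul (Real.exp t)
  rw [intervalIntegrable_iff_integrableOn_Ioo_of_le ht0.le]
  refine IntegrableOn.congr_fun h (fun s hs => ?_) measurableSet_Ioo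
  simp only [ContinuousLinearMap.lsmul_apply, smul_eq_mul]
  rw [weighted_of_pos (sub_pos.2 hs.2), weighted_of_pos hs.1, smul_eq_mul, smul_eq_mul]
  have h1 : Real.exp t * (Real.exp (-1 * (t - s)) * Real.exp (-1 * s)) = 1 := by
    rw [← Real.exp_add, ← Real.exp_add]
    ring_nf
    exact Real.exp_zero
  linear_combination (omega α (t - s) * f s) * h1

variable {H : Type*} [NormedAddCommGroup H] [InnerProductSpace ℝ H] [CompleteSpace H]
  {ι : Type*} [Fintype ι]

/-- The abstract stability estimate for `U = ∑ cᵢ Φᵢ` with scalar coefficients `cᵢ`.  The `Φᵢ` need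
not be linearly independent. -/
theorem norm_sum_smul_le_of_fractional_evolution {σ b C : ℝ} {c : ι → ℝ → ℝ} {Φ : ι → H}
    (hα0 : 0 < α) (hα1 : α < 1) (hT : 0 < T) (hσ : 0 < σ) (hb : 0 ≤ b)
    (hbσ : b * σ ^ (-α) ≤ 1 / 2) (hC : 0 ≤ C)
    (hc : ∀ i, ContinuousOn (c i) (Icc 0 T))
    (hac : ∀ i, ∀ ε ∈ Ioo 0 T, AbsolutelyContinuousOnInterval (c i) ε T)
    (hfW : ∀ᵐ t, t ∈ Ioo 0 T →
      ‖∑ i, deriv (c i) t • Φ i‖ ≤ C * ‖∑ i, fracDeriv α (c i) t • Φ i‖)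
    (hbW : ∀ᵐ t, t ∈ Ioo 0 T →
      inner ℝ (∑ i, deriv (c i) t • Φ i) (∑ i, fracDeriv α (c i) t • Φ i) ≤
        b * ‖∑ i, fracDeriv α (c i) t • Φ i‖ ^ 2) :
    ∀ t ∈ Icc 0 T, ‖∑ i, c i t • Φ i‖ ≤ 2 * Real.exp (σ * T) * ‖∑ i, c i 0 • Φ i‖ := by
  choose η hη0 hη hηc using fun i => exists_oscillation_bound hT (hc i)
  have hdi : ∀ i, ∀ ε ∈ Ioo 0 T, IntegrableOn (deriv (c i)) (Ioc ε T) := fun i ε hε =>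
    (intervalIntegrable_iff_integrableOn_Ioc_of_le hε.2.le).1 (hac i ε hε).intervalIntegrable_deriv
  refine norm_le_of_fractional_evolution (U := fun t => ∑ i, c i t • Φ i)
    (f := fun t => ∑ i, deriv (c i) t • Φ i) (W := fun t => ∑ i, fracDeriv α (c i) t • Φ i)
    (η := fun ε => ∑ i, η i ε * ‖Φ i‖) hα0 hα1 hT hσ hb hbσ hC ?_ ?_
    (fun ε => Finset.sum_nonneg fun i _ => mul_nonneg (hη0 i ε) (norm_nonneg _)) ?_ ?_
    (fun ε hε => integrable_finsetSum _ fun i _ => (hdi i ε hε).smul_const _) ?_ ?_ hfW hbW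
  · refine Finset.aestronglyMeasurable_fun_sum _ fun i _ => ?_
    exact (measurable_deriv (fracInt α (c i))).aestronglyMeasurable.smul_const _
  · refine Finset.aestronglyMeasurable_fun_sum _ fun i _ => ?_
    exact (measurable_deriv (c i)).aestronglyMeasurable.smul_const _
  · have := tendsto_finsetSum (Finset.univ : Finset ι) fun i _ => (hη i).mul_const ‖Φ i‖
    simpa using this
  · refine tendsto_finsetSum (Finset.univ : Finset ι) fun i _ => Tendsto.smul_const ?_ (Φ i)
    have h1 : Tendsto (c i) (𝓝[Icc 0 T] 0) (𝓝 (c i 0)) := hc i 0 ⟨le_rfl, hT.le⟩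
    refine h1.mono_left (nhdsWithin_le_of_mem ?_)
    exact mem_of_superset (Ioo_mem_nhdsGT hT) Ioo_subset_Icc_self
  · intro ε hε t ht
    have hsub : ∀ i, AbsolutelyContinuousOnInterval (c i) ε t := fun i =>
      (hac i ε hε).mono (by
        rw [uIcc_of_le ht.1, uIcc_of_le hε.2.le]; exact Icc_subset_Icc_right ht.2)
    rw [intervalIntegral.integral_finsetSum fun i _ =>
      (⟨(hsub i).intervalIntegrable_deriv.1.smul_const (Φ i),
        (hsub i).intervalIntegrable_deriv.2.smul_const (Φ i)⟩ :
        IntervalIntegrable (fun s => deriv (c i) s • Φ i) volume ε t), ← Finset.sum_add_distrib]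
    refine Finset.sum_congr rfl fun i _ => ?_
    rw [intervalIntegral.integral_smul_const, (hsub i).integral_deriv_eq_sub, ← add_smul,
      add_sub_cancel]
  · intro ε hε
    have h1 := fun i => ae_hasDerivAt_fracInt hα0 hα1 hε (hc i) (hac i ε hε) (hηc i ε hε)
    have h2 := fun i => ae_intervalIntegrable_omega_smul hα0
      (integrable_weighted_indicator zero_le_one (hdi i ε hε))
    filter_upwards [ae_all_iff.2 h1, ae_all_iff.2 h2] with t h1 h2 ht
    choose q hq hd using fun i => h1 i ht
    have hI : ∫ s in (0 : ℝ)..t, omega α (t - s) •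
        (Ioc ε T).indicator (fun t => ∑ i, deriv (c i) t • Φ i) s =
        ∑ i, (∫ s in (0 : ℝ)..t, omega α (t - s) • (Ioc ε T).indicator (deriv (c i)) s) • Φ i := by
      simp_rw [← intervalIntegral.integral_smul_const]
      rw [← intervalIntegral.integral_finsetSum fun i _ =>
        (⟨(h2 i (hε.1.trans ht.1)).1.smul_const (Φ i), (h2 i (hε.1.trans ht.1)).2.smul_const (Φ i)⟩ :
          IntervalIntegrable (fun s => (omega α (t - s) •
            (Ioc ε T).indicator (deriv (c i)) s) • Φ i) volume 0 t)]
      refine intervalIntegral.integral_congr fun s _ => ?_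
      by_cases hs : s ∈ Ioc ε T
      · simp only [indicator_of_mem hs, Finset.smul_sum, smul_assoc]
      · simp only [indicator_of_notMem hs, smul_zero, zero_smul, Finset.sum_const_zero]
    have hsum : ∑ i, fracDeriv α (c i) t • Φ i - (omega α t • ∑ i, c i ε • Φ i +
        ∑ i, (∫ s in (0 : ℝ)..t, omega α (t - s) • (Ioc ε T).indicator (deriv (c i)) s) • Φ i) =
        ∑ i, q i • Φ i := by
      rw [Finset.smul_sum, ← Finset.sum_add_distrib, ← Finset.sum_sub_distrib]
      refine Finset.sum_congr rfl fun i _ => ?_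
      rw [fracDeriv, (hd i).deriv, smul_smul, ← add_smul, ← sub_smul]
      congr 1
      ring
    rw [hI, hsum, Finset.sum_mul]
    refine norm_sum_le_of_le _ fun i _ => ?_
    rw [norm_smul, Real.norm_eq_abs]
    have := mul_le_mul_of_nonneg_right (hq i) (norm_nonneg (Φ i))
    linarith

end FiniteSpan

/-! ### The finite element space -/

section FiniteElements

variable {d : ℕ} {Ω : Set (EuclideanSpace ℝ (Fin d))}
  {K : Geometry.SimplicialComplex ℝ (EuclideanSpace ℝ (Fin d))} {bc : BoundaryCondition}

theorem IsTriangulation.isCompact_closure (hK : IsTriangulation Ω K) : IsCompact (closure Ω) := by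
  rw [← hK.space_eq]
  exact hK.finite.isCompact_biUnion fun s _ => s.finite_toSet.isCompact_convexHull ℝ

theorem IsTriangulation.isFiniteMeasure (hK : IsTriangulation Ω K) :
    IsFiniteMeasure (volume.restrict Ω) :=
  ⟨by
    rw [Measure.restrict_apply_univ]
    exact (measure_mono subset_closure).trans_lt hK.isCompact_closure.measure_lt_top⟩

/-- Almost every point is interior to a mesh element, since the boundary of a convex set is
a null set. -/
theorem IsTriangulation.ae_mem_interior (hK : IsTriangulation Ω K) (hΩ : IsOpen Ω) :
    ∀ᵐ x ∂volume.restrict Ω, ∃ s ∈ K.faces,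
      x ∈ interior (convexHull ℝ (s : Set (EuclideanSpace ℝ (Fin d)))) := by
  have h : ∀ᵐ x : EuclideanSpace ℝ (Fin d), ∀ s ∈ K.faces,
      x ∉ frontier (convexHull ℝ (s : Set (EuclideanSpace ℝ (Fin d)))) := by
    refine (ae_ball_iff hK.finite.countable).2 fun s _ => ?_
    exact measure_eq_zero_iff_ae_notMem.1 (Convex.addHaar_frontier _ (convex_convexHull ℝ _))
  refine (ae_restrict_iff' hΩ.measurableSet).2 ?_
  filter_upwards [h] with x hx hxΩ
  have hxs : x ∈ K.space := hK.space_eq ▸ subset_closure hxΩ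
  obtain ⟨s, hs, hxs⟩ := K.mem_space_iff.1 hxs
  refine ⟨s, hs, ?_⟩
  by_contra hcon
  exact hx s hs ⟨subset_closure hxs, hcon⟩

theorem exists_hasFDerivAt_of_mem_feSpace {v : EuclideanSpace ℝ (Fin d) → ℝ}
    (hv : v ∈ feSpace Ω K bc) {s : Finset (EuclideanSpace ℝ (Fin d))} (hs : s ∈ K.faces) :
    ∃ L : EuclideanSpace ℝ (Fin d) →L[ℝ] ℝ,
      ∀ x ∈ interior (convexHull ℝ (s : Set (EuclideanSpace ℝ (Fin d)))), HasFDerivAt v L x := by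
  obtain ⟨g, hg⟩ := hv.2.1 s hs
  refine ⟨LinearMap.toContinuousLinearMap g.linear, fun x hx => ?_⟩
  have h1 : HasFDerivAt (fun y => LinearMap.toContinuousLinearMap g.linear y + g 0)
      (LinearMap.toContinuousLinearMap g.linear) x :=
    (LinearMap.toContinuousLinearMap g.linear).hasFDerivAt.add_const _
  refine h1.congr_of_eventuallyEq ?_
  filter_upwards [mem_interior_iff_mem_nhds.1 hx] with y hy
  rw [hg hy]
  exact congrFun (AffineMap.decomp g) y

theorem ae_differentiableAt_of_mem_feSpace (hK : IsTriangulation Ω K) (hΩ : IsOpen Ω) :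
    ∀ᵐ x ∂volume.restrict Ω, ∀ v ∈ feSpace Ω K bc, DifferentiableAt ℝ v x := by
  filter_upwards [hK.ae_mem_interior hΩ] with x ⟨s, hs, hx⟩ v hv
  obtain ⟨L, hL⟩ := exists_hasFDerivAt_of_mem_feSpace hv hs
  exact (hL x hx).differentiableAt

theorem gradient_sum_smul {ι : Type*} (s : Finset ι) (a : ι → ℝ)
    (φ : ι → EuclideanSpace ℝ (Fin d) → ℝ) {x : EuclideanSpace ℝ (Fin d)}
    (hφ : ∀ i ∈ s, DifferentiableAt ℝ (φ i) x) :
    gradient (fun y => ∑ i ∈ s, a i * φ i y) x = ∑ i ∈ s, a i • gradient (φ i) x := by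
  unfold gradient
  rw [fderiv_fun_sum fun i hi => (hφ i hi).const_mul (a i), map_sum]
  refine Finset.sum_congr rfl fun i hi => ?_
  rw [fderiv_const_mul (hφ i hi), map_smulₛₗ]
  simp

theorem memLp_of_mem_feSpace (hK : IsTriangulation Ω K) (hΩ : IsOpen Ω)
    {v : EuclideanSpace ℝ (Fin d) → ℝ} (hv : v ∈ feSpace Ω K bc) :
    MemLp v 2 (volume.restrict Ω) := by
  have := hK.isFiniteMeasure
  obtain ⟨C, hC⟩ := hK.isCompact_closure.exists_bound_of_continuousOn hv.1
  refine MemLp.of_bound ((hv.1.mono subset_closure).aestronglyMeasurable hΩ.measurableSet) C ?_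
  exact (ae_restrict_iff' hΩ.measurableSet).2 (Eventually.of_forall fun x hx =>
    hC x (subset_closure hx))

theorem memLp_gradient_of_mem_feSpace (hK : IsTriangulation Ω K) (hΩ : IsOpen Ω)
    {v : EuclideanSpace ℝ (Fin d) → ℝ} (hv : v ∈ feSpace Ω K bc) :
    MemLp (gradient v) 2 (volume.restrict Ω) := by
  have := hK.isFiniteMeasure
  choose! L hL using fun s => exists_hasFDerivAt_of_mem_feSpace (s := s) hv
  have hm : AEStronglyMeasurable (gradient v) (volume.restrict Ω) := by
    refine Measurable.aestronglyMeasurable ?_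
    exact ((InnerProductSpace.toDual ℝ (EuclideanSpace ℝ (Fin d))).symm.continuous.measurable).comp
      (measurable_fderiv ℝ v)
  refine MemLp.of_bound hm (∑ s ∈ hK.finite.toFinset, ‖L s‖) ?_
  filter_upwards [hK.ae_mem_interior hΩ] with x ⟨s, hs, hx⟩
  rw [gradient, LinearIsometryEquiv.norm_map, (hL s hs x hx).fderiv]
  exact Finset.single_le_sum (f := fun s => ‖L s‖) (fun s _ => norm_nonneg _)
    (hK.finite.mem_toFinset.2 hs)

/-- The embedding of the finite element space into `L₂(Ω)`. -/
noncomputable def feToLp (hK : IsTriangulation Ω K) (hΩ : IsOpen Ω) (bc : BoundaryCondition) :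
    feSpace Ω K bc →ₗ[ℝ] Lp ℝ 2 (volume.restrict Ω) where
  toFun v := (memLp_of_mem_feSpace hK hΩ v.2).toLp v.1
  map_add' v w := MemLp.toLp_add (memLp_of_mem_feSpace hK hΩ v.2) (memLp_of_mem_feSpace hK hΩ w.2)
  map_smul' c v := MemLp.toLp_const_smul c (memLp_of_mem_feSpace hK hΩ v.2)

/-- The gradient on the finite element space, with values in `L₂(Ω)ᵈ`. -/
noncomputable def feGradient (hK : IsTriangulation Ω K) (hΩ : IsOpen Ω) (bc : BoundaryCondition) :
    feSpace Ω K bc →ₗ[ℝ] Lp (EuclideanSpace ℝ (Fin d)) 2 (volume.restrict Ω) where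
  toFun v := (memLp_gradient_of_mem_feSpace hK hΩ v.2).toLp (gradient v.1)
  map_add' v w := by
    rw [← MemLp.toLp_add]
    refine MemLp.toLp_congr _ _ ?_
    filter_upwards [ae_differentiableAt_of_mem_feSpace (bc := bc) hK hΩ] with x hx
    have h := gradient_sum_smul (Finset.univ : Finset (Fin 2)) ![1, 1] ![v.1, w.1] (x := x)
      (by
        intro i _
        fin_cases i
        · exact hx _ v.2
        · exact hx _ w.2)
    simp only [Fin.sum_univ_two, Matrix.cons_val_zero, Matrix.cons_val_one, one_mul,
      one_smul] at h
    exact h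
  map_smul' c v := by
    rw [RingHom.id_apply, ← MemLp.toLp_const_smul]
    refine MemLp.toLp_congr _ _ ?_
    filter_upwards [ae_differentiableAt_of_mem_feSpace (bc := bc) hK hΩ] with x hx
    have h := gradient_sum_smul (Finset.univ : Finset (Fin 1)) ![c] ![v.1] (x := x)
      (by
        intro i _
        fin_cases i
        exact hx _ v.2)
    simp only [Finset.univ_unique, Finset.sum_singleton, Matrix.cons_val_fin_one] at h
    exact h

theorem coeFn_feToLp (hK : IsTriangulation Ω K) (hΩ : IsOpen Ω) (v : feSpace Ω K bc) :
    feToLp hK hΩ bc v =ᵐ[volume.restrict Ω] v.1 :=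
  MemLp.coeFn_toLp (memLp_of_mem_feSpace hK hΩ v.2)

theorem coeFn_feGradient (hK : IsTriangulation Ω K) (hΩ : IsOpen Ω) (v : feSpace Ω K bc) :
    feGradient hK hΩ bc v =ᵐ[volume.restrict Ω] gradient v.1 :=
  MemLp.coeFn_toLp (memLp_gradient_of_mem_feSpace hK hΩ v.2)

theorem inner_feToLp (hK : IsTriangulation Ω K) (hΩ : IsOpen Ω) (v w : feSpace Ω K bc) :
    inner ℝ (feToLp hK hΩ bc v) (feToLp hK hΩ bc w) = ip Ω v.1 w.1 := by
  rw [L2.inner_def, ip]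
  refine integral_congr_ae ?_
  filter_upwards [coeFn_feToLp hK hΩ v, coeFn_feToLp hK hΩ w] with x h1 h2
  rw [h1, h2, real_inner_eq_re_inner]
  simp [mul_comm]

theorem inner_feGradient (hK : IsTriangulation Ω K) (hΩ : IsOpen Ω) (v w : feSpace Ω K bc) :
    inner ℝ (feGradient hK hΩ bc v) (feGradient hK hΩ bc w) =
      ipVec Ω (gradient v.1) (gradient w.1) := by
  rw [L2.inner_def, ipVec]
  refine integral_congr_ae ?_
  filter_upwards [coeFn_feGradient hK hΩ v, coeFn_feGradient hK hΩ w] with x h1 h2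
  rw [h1, h2]

theorem norm_feToLp (hK : IsTriangulation Ω K) (hΩ : IsOpen Ω) (v : feSpace Ω K bc) :
    ‖feToLp hK hΩ bc v‖ = l2Norm Ω v.1 := by
  rw [l2Norm, ← inner_feToLp hK hΩ, real_inner_self_eq_norm_sq, Real.sqrt_sq (norm_nonneg _)]

theorem feToLp_injective (hK : IsTriangulation Ω K) (hΩ : IsOpen Ω) :
    Function.Injective (feToLp hK hΩ bc) := by
  rw [← LinearMap.ker_eq_bot, LinearMap.ker_eq_bot']
  intro v hv
  have h1 : v.1 =ᵐ[volume.restrict Ω] fun _ => (0 : ℝ) := by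
    have h2 := coeFn_feToLp hK hΩ v
    rw [hv] at h2
    exact h2.symm.trans (Lp.coeFn_zero _ _ _)
  have h2 : EqOn v.1 (fun _ => (0 : ℝ)) Ω :=
    Measure.eqOn_open_of_ae_eq h1 hΩ (v.2.1.mono subset_closure) continuousOn_const
  have h3 : EqOn v.1 (fun _ => (0 : ℝ)) (closure Ω) :=
    h2.of_subset_closure v.2.1 continuousOn_const subset_closure subset_rfl
  ext x
  by_cases hx : x ∈ closure Ω
  · exact h3 hx
  · exact v.2.2.2.2 x hx

theorem IsTriangulation.finite_vertices (hK : IsTriangulation Ω K) : K.vertices.Finite := by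
  rw [K.vertices_eq]
  exact hK.finite.biUnion fun s _ => s.finite_toSet

/-- Evaluation of finite element functions at the vertices of the mesh. -/
noncomputable def vertexEval (Ω : Set (EuclideanSpace ℝ (Fin d)))
    (K : Geometry.SimplicialComplex ℝ (EuclideanSpace ℝ (Fin d))) (bc : BoundaryCondition) :
    feSpace Ω K bc →ₗ[ℝ] (K.vertices → ℝ) where
  toFun v z := v.1 z
  map_add' _ _ := rfl
  map_smul' _ _ := rfl

theorem vertexEval_injective (hK : IsTriangulation Ω K) :
    Function.Injective (vertexEval Ω K bc) := by
  rw [← LinearMap.ker_eq_bot, LinearMap.ker_eq_bot']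
  intro v hv
  ext x
  by_cases hx : x ∈ closure Ω
  · rw [← hK.space_eq] at hx
    obtain ⟨s, hs, hxs⟩ := K.mem_space_iff.1 hx
    obtain ⟨g, hg⟩ := v.2.2.1 s hs
    rw [hg hxs]
    have hz : ∀ y ∈ (s : Set (EuclideanSpace ℝ (Fin d))), g y = 0 := by
      intro y hy
      rw [← hg (subset_convexHull ℝ _ hy)]
      exact congrFun hv ⟨y, by rw [K.vertices_eq]; exact mem_biUnion hs hy⟩
    have hconv : Convex ℝ (g ⁻¹' {0}) := (convex_singleton (0:ℝ)).affine_preimage g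
    exact convexHull_min hz hconv hxs
  · exact v.2.2.2.2 x hx

/-- A spanning set of the finite element space, in which the coefficients of a function are its
values at the vertices. -/
theorem exists_vertex_expansion [Fintype K.vertices] (hK : IsTriangulation Ω K)
    (bc : BoundaryCondition) : ∃ φ : K.vertices → feSpace Ω K bc,
      ∀ v : feSpace Ω K bc, v = ∑ z : K.vertices, v.1 z • φ z := by
  classical
  obtain ⟨R, hR⟩ := (vertexEval Ω K bc).exists_leftInverse_of_injective
    (LinearMap.ker_eq_bot.2 (vertexEval_injective hK))
  refine ⟨fun z => R (Pi.single z 1), fun v => ?_⟩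
  have h1 : R (vertexEval Ω K bc v) = v := LinearMap.congr_fun hR v
  have h2 : vertexEval Ω K bc v = ∑ z : K.vertices, v.1 z • Pi.single z (1 : ℝ) := by
    ext y
    simp [Finset.sum_apply, Pi.single_apply, vertexEval]
  rw [h2, map_sum] at h1
  simp only [map_smul] at h1
  exact h1.symm

/-- Inverse inequality: on the finite element space, the gradient is bounded in `L₂(Ω)`. -/
theorem exists_inverse_inequality (hK : IsTriangulation Ω K) (hΩ : IsOpen Ω)
    (bc : BoundaryCondition) : ∃ G : ℝ, 0 ≤ G ∧
      ∀ v : feSpace Ω K bc, ‖feGradient hK hΩ bc v‖ ≤ G * ‖feToLp hK hΩ bc v‖ := by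
  have := hK.finite_vertices.fintype
  have hfd : FiniteDimensional ℝ (feSpace Ω K bc) :=
    FiniteDimensional.of_injective (vertexEval Ω K bc) (vertexEval_injective hK)
  let e := LinearEquiv.ofInjective (feToLp hK hΩ bc) (feToLp_injective hK hΩ)
  let A := LinearMap.toContinuousLinearMap ((feGradient hK hΩ bc).comp e.symm.toLinearMap)
  refine ⟨‖A‖, A.opNorm_nonneg, fun v => ?_⟩
  have h := A.le_opNorm (e v)
  simpa [A, e] using h

end FiniteElements

/-! ### The semidiscrete equation at almost every time -/

section Semidiscrete

/-- The fractional derivative of a finite sum `∑ cᵢ vᵢ`; the differentiability hypothesis excludes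
the junk value of `deriv`. -/
theorem fracDeriv_eq_sum_smul {X : Type*} [NormedAddCommGroup X] [NormedSpace ℝ X]
    [CompleteSpace X] {ι : Type*} [Fintype ι] {α T : ℝ} (hα : 0 < α) {c : ι → ℝ → ℝ}
    (hc : ∀ i, ContinuousOn (c i) (Icc 0 T)) {t : ℝ} (ht : t ∈ Ioo 0 T)
    (hd : ∀ i, DifferentiableAt ℝ (fracInt α (c i)) t) {g : ℝ → X} {v : ι → X}
    (hg : ∀ s ∈ Icc 0 T, g s = ∑ i, c i s • v i) :
    fracDeriv α g t = ∑ i, fracDeriv α (c i) t • v i := by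
  have h : fracInt α g =ᶠ[𝓝 t] fun r => ∑ i, fracInt α (c i) r • v i := by
    filter_upwards [isOpen_Ioo.mem_nhds ht] with r hr
    simp only [fracInt]
    simp_rw [← intervalIntegral.integral_smul_const]
    have hi : ∀ i, IntervalIntegrable (fun s => omega α (r - s) • c i s) volume 0 r := fun i =>
      (intervalIntegrable_omega_sub hα r 0 r).mul_continuousOn (by
        rw [uIcc_of_le hr.1.le]; exact (hc i).mono (Icc_subset_Icc_right hr.2.le))
    rw [← intervalIntegral.integral_finsetSum fun i _ =>
      (⟨(hi i).1.smul_const (v i), (hi i).2.smul_const (v i)⟩ :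
        IntervalIntegrable (fun s => (omega α (r - s) • c i s) • v i) volume 0 r)]
    refine intervalIntegral.integral_congr fun s hs => ?_
    rw [uIcc_of_le hr.1.le] at hs
    simp only [hg s ⟨hs.1, hs.2.trans hr.2.le⟩, Finset.smul_sum, smul_assoc]
  rw [fracDeriv, h.deriv_eq]
  exact (HasDerivAt.fun_sum fun i _ => (hd i).hasDerivAt.smul_const (v i)).deriv

theorem ae_differentiableAt_fracInt {α T : ℝ} (hα0 : 0 < α) (hα1 : α < 1) (hT : 0 < T)
    {c : ℝ → ℝ} (hc : ContinuousOn c (Icc 0 T))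
    (hac : ∀ ε ∈ Ioo 0 T, AbsolutelyContinuousOnInterval c ε T) :
    ∀ᵐ t, t ∈ Ioo 0 T → DifferentiableAt ℝ c t ∧ DifferentiableAt ℝ (fracInt α c) t := by
  obtain ⟨η, -, -, hη⟩ := exists_oscillation_bound hT hc
  have hn : ∀ n : ℕ, T / (n + 2) ∈ Ioo 0 T := fun n => by
    have hn : (0:ℝ) ≤ n := n.cast_nonneg
    refine ⟨by positivity, ?_⟩
    rw [div_lt_iff₀ (by positivity)]
    nlinarith
  have h1 := fun n : ℕ => ae_hasDerivAt_fracInt hα0 hα1 (hn n) hc (hac _ (hn n)) (hη _ (hn n))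
  have h2 := fun n : ℕ => (hac _ (hn n)).ae_differentiableAt
  filter_upwards [ae_all_iff.2 h1, ae_all_iff.2 h2] with t h1 h2 ht
  have hat : Tendsto (fun n : ℕ => T / ((n : ℝ) + 2)) atTop (𝓝 0) :=
    tendsto_const_nhds.div_atTop (tendsto_atTop_add_const_right _ _ tendsto_natCast_atTop_atTop)
  obtain ⟨n, hnt⟩ := (hat.eventually (eventually_lt_nhds ht.1)).exists
  obtain ⟨q, -, hq⟩ := h1 n ⟨hnt, ht.2⟩
  refine ⟨h2 n ?_, hq.differentiableAt⟩
  rw [uIcc_of_le (hn n).2.le]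
  exact ⟨hnt.le, ht.2.le⟩

variable {d : ℕ} {Ω : Set (EuclideanSpace ℝ (Fin d))}
  {K : Geometry.SimplicialComplex ℝ (EuclideanSpace ℝ (Fin d))} {bc : BoundaryCondition}

theorem IsForcing.ae_bound {T : ℝ} {M₀ M₁ : NNReal}
    {F : EuclideanSpace ℝ (Fin d) × ℝ → EuclideanSpace ℝ (Fin d)} (hF : IsForcing Ω T M₀ M₁ F) :
    ∀ᵐ t ∂volume.restrict (Ioo 0 T),
      AEStronglyMeasurable (fun x => F (x, t)) (volume.restrict Ω) ∧
      ∀ᵐ x ∂volume.restrict Ω, ‖F (x, t)‖ ≤ M₀ := by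
  obtain ⟨⟨hFm, hFb⟩, -⟩ := hF
  have hprod : (volume : Measure (EuclideanSpace ℝ (Fin d) × ℝ)).restrict (Ω ×ˢ Ioo 0 T) =
      (volume.restrict Ω).prod (volume.restrict (Ioo 0 T)) := by
    rw [Measure.volume_eq_prod, Measure.prod_restrict]
  rw [hprod] at hFm hFb
  have hb : ∀ᵐ z ∂(volume.restrict Ω).prod (volume.restrict (Ioo (0:ℝ) T)), ‖F z‖ ≤ M₀ := by
    rw [eLpNorm_exponent_top] at hFb
    filter_upwards [ae_le_eLpNormEssSup (f := F)
      (μ := (volume.restrict Ω).prod (volume.restrict (Ioo (0:ℝ) T)))] with z hz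
    have h := hz.trans hFb
    rw [enorm_eq_nnnorm] at h
    exact_mod_cast h
  have hb' := Measure.ae_ae_of_ae_prod
    ((Measure.measurePreserving_swap (μ := volume.restrict (Ioo (0:ℝ) T))
      (ν := volume.restrict Ω)).quasiMeasurePreserving.ae hb)
  have hm' := hFm.1.prod_swap.prodMk_left
  filter_upwards [hb', hm'] with t h1 h2
  exact ⟨h2, h1⟩

/-- The transport term, as a bounded functional of the gradient. -/
theorem exists_transport_vector (hK : IsTriangulation Ω K) (hΩ : IsOpen Ω) {M : ℝ}
    {b : EuclideanSpace ℝ (Fin d) → EuclideanSpace ℝ (Fin d)}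
    (hbm : AEStronglyMeasurable b (volume.restrict Ω))
    (hb : ∀ᵐ x ∂volume.restrict Ω, ‖b x‖ ≤ M) (w : feSpace Ω K bc) :
    ∃ B : Lp (EuclideanSpace ℝ (Fin d)) 2 (volume.restrict Ω),
      ‖B‖ ≤ M * ‖feToLp hK hΩ bc w‖ ∧ ∀ χ : feSpace Ω K bc,
        inner ℝ B (feGradient hK hΩ bc χ) = ipVec Ω (fun x => w.1 x • b x) (gradient χ.1) := by
  have hw := memLp_of_mem_feSpace hK hΩ w.2
  have hle : ∀ᵐ x ∂volume.restrict Ω, ‖w.1 x • b x‖ ≤ M * ‖w.1 x‖ := by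
    filter_upwards [hb] with x hx
    rw [norm_smul, mul_comm]
    exact mul_le_mul_of_nonneg_right hx (norm_nonneg _)
  have hB : MemLp (fun x => w.1 x • b x) 2 (volume.restrict Ω) :=
    MemLp.of_le_mul hw (hw.1.smul hbm) hle
  refine ⟨hB.toLp _, ?_, fun χ => ?_⟩
  · refine Lp.norm_le_mul_norm_of_ae_le_mul ?_
    filter_upwards [hle, hB.coeFn_toLp, coeFn_feToLp hK hΩ w] with x h1 h2 h3
    rw [h2, h3]
    exact h1
  · rw [L2.inner_def, ipVec]
    refine integral_congr_ae ?_
    filter_upwards [hB.coeFn_toLp, coeFn_feGradient hK hΩ χ] with x h1 h2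
    rw [h1, h2]

/-- Testing the equation `⟨f, χ⟩ + ⟨∇w, ∇χ⟩ - ⟨B, ∇χ⟩ = 0` with `χ = w`, and with `χ = f`. -/
theorem inner_le_and_norm_le_of_equation (hK : IsTriangulation Ω K) (hΩ : IsOpen Ω) {M G : ℝ}
    (hM : 0 ≤ M) (hG : 0 ≤ G)
    (hinv : ∀ v : feSpace Ω K bc, ‖feGradient hK hΩ bc v‖ ≤ G * ‖feToLp hK hΩ bc v‖)
    {f w : feSpace Ω K bc} {B : Lp (EuclideanSpace ℝ (Fin d)) 2 (volume.restrict Ω)}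
    (hB : ‖B‖ ≤ M * ‖feToLp hK hΩ bc w‖)
    (h : ∀ χ : feSpace Ω K bc, inner ℝ (feToLp hK hΩ bc f) (feToLp hK hΩ bc χ) +
      inner ℝ (feGradient hK hΩ bc w) (feGradient hK hΩ bc χ) -
      inner ℝ B (feGradient hK hΩ bc χ) = 0) :
    inner ℝ (feToLp hK hΩ bc f) (feToLp hK hΩ bc w) ≤ M ^ 2 / 4 * ‖feToLp hK hΩ bc w‖ ^ 2 ∧
      ‖feToLp hK hΩ bc f‖ ≤ ((G + M) * G) * ‖feToLp hK hΩ bc w‖ := by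
  have hw0 := norm_nonneg (feToLp hK hΩ bc w)
  constructor
  · have h1 := h w
    rw [real_inner_self_eq_norm_sq] at h1
    have h2 := real_inner_le_norm B (feGradient hK hΩ bc w)
    have h3 := mul_le_mul_of_nonneg_right hB (norm_nonneg (feGradient hK hΩ bc w))
    nlinarith [sq_nonneg (‖feGradient hK hΩ bc w‖ - M * ‖feToLp hK hΩ bc w‖ / 2)]
  · have h1 := h f
    rw [real_inner_self_eq_norm_sq] at h1
    have h2 := real_inner_le_norm B (feGradient hK hΩ bc f)
    have h3 := neg_le_of_abs_le
      (abs_real_inner_le_norm (feGradient hK hΩ bc w) (feGradient hK hΩ bc f))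
    have h4 := hinv w
    have h5 := hinv f
    have h6 : ‖feToLp hK hΩ bc f‖ ^ 2 ≤
        (‖feGradient hK hΩ bc w‖ + ‖B‖) * ‖feGradient hK hΩ bc f‖ := by linarith
    have h7 : (‖feGradient hK hΩ bc w‖ + ‖B‖) * ‖feGradient hK hΩ bc f‖ ≤
        ((G + M) * ‖feToLp hK hΩ bc w‖) * (G * ‖feToLp hK hΩ bc f‖) :=
      mul_le_mul (by linarith) h5 (norm_nonneg _) (by positivity)
    rcases (norm_nonneg (feToLp hK hΩ bc f)).eq_or_lt with h0 | h0
    · rw [← h0]; positivity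
    · refine le_of_mul_le_mul_right ?_ h0
      nlinarith

/-- In terms of vertex values, the semidiscrete equation reads `⟨f, χ⟩ + ⟨∇w, ∇χ⟩ = ⟨F w, ∇χ⟩`
with `f = ∂ₜu` and `w = ∂ₜ^(1-α) u` in the finite element space. -/
theorem IsSemidiscreteSolution.ae_equation [Fintype K.vertices] {α T : ℝ} (hα0 : 0 < α)
    (hα1 : α < 1) (hT : 0 < T) (hΩ : IsOpen Ω) (hK : IsTriangulation Ω K)
    {F : EuclideanSpace ℝ (Fin d) × ℝ → EuclideanSpace ℝ (Fin d)}
    {u₀ : EuclideanSpace ℝ (Fin d) → ℝ} {u : ℝ → EuclideanSpace ℝ (Fin d) → ℝ}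
    (hu : IsSemidiscreteSolution Ω K bc α T F u₀ u) {φ : K.vertices → feSpace Ω K bc}
    (hφ : ∀ v : feSpace Ω K bc, v = ∑ z : K.vertices, v.1 z • φ z) :
    ∀ᵐ t, t ∈ Ioo 0 T → ∀ χ : feSpace Ω K bc,
      ip Ω (∑ z : K.vertices, deriv (fun s => u s z) t • φ z : feSpace Ω K bc).1 χ.1 +
      ipVec Ω (gradient (∑ z : K.vertices, fracDeriv α (fun s => u s z) t • φ z :
        feSpace Ω K bc).1) (gradient χ.1) -
      ipVec Ω (fun x => (∑ z : K.vertices, fracDeriv α (fun s => u s z) t • φ z :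
        feSpace Ω K bc).1 x • F (x, t)) (gradient χ.1) = 0 := by
  have hcl : ∀ z : K.vertices, (z : EuclideanSpace ℝ (Fin d)) ∈ closure Ω := fun z =>
    hK.space_eq ▸ K.vertices_subset_space z.2
  have hc : ∀ z : K.vertices, ContinuousOn (fun s => u s z) (Icc 0 T) := fun z =>
    hu.continuous z (hcl z)
  have hd := fun z : K.vertices => ae_differentiableAt_fracInt hα0 hα1 hT (hc z)
    (hu.absolutelyContinuous z (hcl z))
  have hcoe : ∀ (a : K.vertices → ℝ), (∑ z, a z • φ z : feSpace Ω K bc).1 =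
      fun x => ∑ z, a z * (φ z).1 x := by
    intro a
    ext x
    rw [Submodule.coe_sum, Finset.sum_apply]
    rfl
  have hexp : ∀ s ∈ Icc 0 T, u s = fun x => ∑ z : K.vertices, u s z * (φ z).1 x := by
    intro s hs
    rw [← hcoe]
    exact congrArg Subtype.val (hφ ⟨u s, hu.mem s hs⟩)
  have heq := (ae_restrict_iff' measurableSet_Ioo).1 hu.equation
  filter_upwards [ae_all_iff.2 hd, heq] with t hd heq ht χ
  rw [← heq ht χ.1 χ.2]
  have e1 : ∀ x, deriv (fun s => u s x) t =
      (∑ z : K.vertices, deriv (fun s => u s z) t • φ z : feSpace Ω K bc).1 x := by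
    intro x
    rw [hcoe]
    have h : (fun s => u s x) =ᶠ[𝓝 t] fun s => ∑ z : K.vertices, u s z * (φ z).1 x := by
      filter_upwards [isOpen_Ioo.mem_nhds ht] with s hs
      exact congrFun (hexp s (Ioo_subset_Icc_self hs)) x
    rw [h.deriv_eq]
    exact (HasDerivAt.fun_sum fun z _ => (hd z ht).1.hasDerivAt.mul_const ((φ z).1 x)).deriv
  have e2 : ∀ x, fracDeriv α (fun s => u s x) t =
      (∑ z : K.vertices, fracDeriv α (fun s => u s z) t • φ z : feSpace Ω K bc).1 x := by
    intro x
    rw [hcoe]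
    exact fracDeriv_eq_sum_smul hα0 hc ht (fun z => (hd z ht).2) (v := fun z => (φ z).1 x)
      fun s hs => congrFun (hexp s hs) x
  have e3 : ∀ᵐ x ∂volume.restrict Ω, fracDeriv α (fun s => gradient (u s) x) t =
      gradient (∑ z : K.vertices, fracDeriv α (fun s => u s z) t • φ z : feSpace Ω K bc).1 x := by
    filter_upwards [ae_differentiableAt_of_mem_feSpace (bc := bc) hK hΩ] with x hx
    rw [hcoe, gradient_sum_smul _ _ _ fun z _ => hx _ (φ z).2]
    refine fracDeriv_eq_sum_smul hα0 hc ht (fun z => (hd z ht).2) fun s hs => ?_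
    conv_lhs => rw [hexp s hs]
    exact gradient_sum_smul _ _ _ fun z _ => hx _ (φ z).2
  congr 1
  · congr 1
    · rw [funext e1]
    · unfold ipVec
      refine integral_congr_ae ?_
      filter_upwards [e3] with x hx
      rw [hx]
  · rw [funext fun x => congrArg (fun r : ℝ => r • F (x, t)) (e2 x)]

/-- The stability estimate; the constant depends on `F` only through `M₀`, by way of `σ`. -/
theorem IsSemidiscreteSolution.l2Norm_le {α T σ : ℝ} {M₀ M₁ : NNReal} (hα0 : 0 < α)
    (hα1 : α < 1) (hT : 0 < T) (hσ : 0 < σ) (hMσ : (M₀ : ℝ) ^ 2 / 4 * σ ^ (-α) ≤ 1 / 2)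
    (hΩ : IsOpen Ω) (hK : IsTriangulation Ω K)
    {F : EuclideanSpace ℝ (Fin d) × ℝ → EuclideanSpace ℝ (Fin d)} (hF : IsForcing Ω T M₀ M₁ F)
    {u₀ : EuclideanSpace ℝ (Fin d) → ℝ} {u : ℝ → EuclideanSpace ℝ (Fin d) → ℝ}
    (hu : IsSemidiscreteSolution Ω K bc α T F u₀ u) :
    ∀ t ∈ Icc 0 T, l2Norm Ω (u t) ≤ 2 * Real.exp (σ * T) * l2Norm Ω u₀ := by
  have := hK.finite_vertices.fintype
  obtain ⟨φ, hφ⟩ := exists_vertex_expansion hK bc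
  obtain ⟨G, hG, hinv⟩ := exists_inverse_inequality hK hΩ bc
  have hcl : ∀ z : K.vertices, (z : EuclideanSpace ℝ (Fin d)) ∈ closure Ω := fun z =>
    hK.space_eq ▸ K.vertices_subset_space z.2
  have hmap : ∀ a : K.vertices → ℝ, ∑ z, a z • feToLp hK hΩ bc (φ z) =
      feToLp hK hΩ bc (∑ z, a z • φ z) := by
    intro a
    simp only [map_sum, map_smul]
  have hnorm : ∀ t ∈ Icc 0 T, ‖∑ z : K.vertices, u t z • feToLp hK hΩ bc (φ z)‖ =
      l2Norm Ω (u t) := by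
    intro t ht
    rw [hmap, ← hφ ⟨u t, hu.mem t ht⟩, norm_feToLp]
  have hM : (0 : ℝ) ≤ M₀ := M₀.2
  have hkey : ∀ᵐ t, t ∈ Ioo 0 T →
      inner ℝ (∑ z : K.vertices, deriv (fun s => u s z) t • feToLp hK hΩ bc (φ z))
        (∑ z : K.vertices, fracDeriv α (fun s => u s z) t • feToLp hK hΩ bc (φ z)) ≤
        (M₀ : ℝ) ^ 2 / 4 *
          ‖∑ z : K.vertices, fracDeriv α (fun s => u s z) t • feToLp hK hΩ bc (φ z)‖ ^ 2 ∧
      ‖∑ z : K.vertices, deriv (fun s => u s z) t • feToLp hK hΩ bc (φ z)‖ ≤ ((G + M₀) * G) *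
        ‖∑ z : K.vertices, fracDeriv α (fun s => u s z) t • feToLp hK hΩ bc (φ z)‖ := by
    filter_upwards [hu.ae_equation hα0 hα1 hT hΩ hK hφ,
      (ae_restrict_iff' measurableSet_Ioo).1 hF.ae_bound] with t h1 h2 ht
    obtain ⟨hbm, hb⟩ := h2 ht
    obtain ⟨B, hB, hBχ⟩ := exists_transport_vector hK hΩ hbm hb
      (∑ z : K.vertices, fracDeriv α (fun s => u s z) t • φ z)
    rw [hmap, hmap]
    refine inner_le_and_norm_le_of_equation hK hΩ hM hG hinv hB fun χ => ?_
    rw [inner_feToLp, inner_feGradient, hBχ]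
    exact h1 ht χ
  have h := norm_sum_smul_le_of_fractional_evolution (c := fun (z : K.vertices) s => u s z)
    (Φ := fun z => feToLp hK hΩ bc (φ z)) (b := (M₀ : ℝ) ^ 2 / 4) (C := (G + M₀) * G)
    hα0 hα1 hT hσ (by positivity) hMσ (by positivity) (fun z => hu.continuous z (hcl z))
    (fun z => hu.absolutelyContinuous z (hcl z))
    (hkey.mono fun t h ht => (h ht).2) (hkey.mono fun t h ht => (h ht).1)
  intro t ht
  rw [← hu.initial, ← hnorm t ht, ← hnorm 0 ⟨le_rfl, hT.le⟩]
  exact h t ht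

end Semidiscrete

end FokkerPlanck

/-- The constant is `2 e^(σT)`, where `σ` is chosen so that `(M₀² / 4) σ^(-α) ≤ 1 / 2`. -/
theorem theorem4p1 (α T : ℝ) (hα0 : 0 < α) (hα1 : α < 1) (hT : 0 < T) (M₀ M₁ : NNReal) :
    ∃ C : ℝ, ∀ (d : ℕ), 1 ≤ d →
      ∀ Ω : Set (EuclideanSpace ℝ (Fin d)), FokkerPlanck.IsPolyhedralDomain Ω →
      ∀ F : EuclideanSpace ℝ (Fin d) × ℝ → EuclideanSpace ℝ (Fin d),
        FokkerPlanck.IsForcing Ω T M₀ M₁ F →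
      ∀ K : Geometry.SimplicialComplex ℝ (EuclideanSpace ℝ (Fin d)),
        FokkerPlanck.IsTriangulation Ω K →
      ∀ (bc : FokkerPlanck.BoundaryCondition) (u₀ : EuclideanSpace ℝ (Fin d) → ℝ)
        (u : ℝ → EuclideanSpace ℝ (Fin d) → ℝ),
        FokkerPlanck.IsSemidiscreteSolution Ω K bc α T F u₀ u →
      ∀ t ∈ Set.Icc 0 T, FokkerPlanck.l2Norm Ω (u t) ≤ C * FokkerPlanck.l2Norm Ω u₀ := by
  obtain ⟨σ, hσ, hMσ⟩ := FokkerPlanck.exists_pos_mul_rpow_neg_le hα0 ((M₀ : ℝ) ^ 2 / 4)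
  exact ⟨2 * Real.exp (σ * T), fun d _ Ω hΩ F hF K hK bc u₀ u hu =>
    hu.l2Norm_le hα0 hα1 hT hσ hMσ hΩ.isOpen hK hF⟩
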